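/- Let $s\ge 1$ and let $\gamma=(\gamma_u)_{u\subseteq\{1,\dots,s\}}$ be weights with $\gamma_u\ge 0$. Let $\mathcal H(K^{\rm sob}_{2,\gamma,s})$ be the weighted non-periodic Sobolev space of order $2$, that is, the reproducing kernel Hilbert space of real functions on $[0,1]^s$ with kernel $$K^{\rm sob}_{2,\gamma,s}(x,y)=1+\sum_{\emptyset\ne u\subseteq\{1,\dots,s\}}\gamma_u\prod_{j\in u}\Big(\sum_{\tau=1}^{2}\frac{B_\tau(x_j)B_\tau(y_j)}{(\tau!)^2}-\frac{B_4(|x_j-y_j|)}{4!}\Big),$$ where $B_\tau$ is the Bernoulli polynomial of degree $\tau$. For weights $w=(w_u)_u$ let $\mathcal H(K^{\rm kor}_{1,w,s})$ be the weighted Korobov space of smoothness $1$, that is, the reproducing kernel Hilbert space on $[0,1]^s$ with kernel $\sum_{h\in\mathbb Z^s}r_w(h)e^{2\pi i h\cdot(x-y)}$, where $r_w(0)=1$ and $r_w(h)=w_u\prod_{j\in u}|h_j|^{-2}$ for $h\neq 0$ with support $u$. All functions in these spaces are integrable. For a finite multiset $P\subset[0,1]^s$ and such a space $V$ let $$e^{\rm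 wor}(P;V)=\sup_{f\in V,\ \|f\|_V\le 1}\Big|\frac1{|P|}\sum_{x\in P}f(x)-\int_{[0,1]^s}f(x)\,dx\Big|.$$ For $z\in\{1,\dots,N-1\}^s$ let $P_{N,z}$ be the multiset of the points $\{nz/N\}$, $0\le n<N$ (fractional parts taken componentwise), and let $P^{\phi}_{N,z}$ be its image under the tent transformation $\phi(x)=1-|2x-1|$, applied componentwise. Put $c'=58/3$, $\gamma'_u=\gamma_u\,(c'/(4\pi^4))^{|u|}$ and $\gamma'^{1/2}=(\gamma_u'^{1/2})_u$. Let $N$ be prime. The component-by-component (CBC) algorithm with quality criterion $(e^{\rm wor}(P_{N,z};\mathcal H(K^{\rm kor}_{1,\gamma'^{1/2},d})))^2$ chooses successively, for $d=1,\dots,s$ and with $z_1,\dots,z_{d-1}$ kept fixed, a $z_d\in\{1,\dots,N-1\}$ that minimizes the criterion for $(z_1,\dots,z_d)$ in dimension $d$ (with the weights of the subsets of $\{1,\dots,d\}$). It has an output, and every output $z\in\{1,\dots,N-1\}^s$ (however ties are broken) satisfies $$e^{\rm wor}(P^{\phi}_{N,z};\mathcal H(K^{\rm sob}_{2,\gamma,s}))\le\big(e^{\rm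 wor}(P_{N,z};\mathcal H(K^{\rm kor}_{1,\gamma'^{1/2},s}))\big)^2\le\frac1{(N-1)^{1/\lambda}}\Big(\sum_{\emptyset\ne u\subseteq\{1,\dots,s\}}\gamma_u^{\lambda/2}\Big(\frac{2^{1-\lambda}c'^{\lambda/2}\zeta(2\lambda)}{\pi^{2\lambda}}\Big)^{|u|}\Big)^{1/\lambda}$$ for every $\lambda\in(1/2,1]$, where $\zeta$ is the Riemann zeta function. Consequently, for every $\varepsilon>0$ there is a constant $C$, depending only on $s$, $\gamma$ and $\varepsilon$, such that $e^{\rm wor}(P^{\phi}_{N,z};\mathcal H(K^{\rm sob}_{2,\gamma,s}))\le C\,N^{-2+\varepsilon}$ for all primes $N$ and all outputs $z$ of the algorithm. -/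

import Mathlib

open MeasureTheory unitInterval
open scoped NNReal ENNReal

noncomputable section

namespace TentLattice

/-! ### Reproducing kernel Hilbert spaces of real functions -/

section Kernels

variable {X : Type}

/-- A real kernel `k : X × X → ℝ`, as a matrix of operators on `ℝ`
(the format of `RKHS.OfKernel`): the entry at `(x, y)` is multiplication by `k x y`. -/
def kernelMatrix (k : X → X → ℝ) : Matrix X X (ℝ →L[ℝ] ℝ) :=
  Matrix.of fun x y => k x y • ContinuousLinearMap.id ℝ ℝ

/-- Auxiliary for positive semidefiniteness: `k` has an expansion `k x y = ∑ₙ fₙ x * fₙ y`. -/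
def HasFeatures (k : X → X → ℝ) : Prop :=
  ∃ (ι : Type) (f : ι → X → ℝ), ∀ x y, HasSum (fun n => f n x * f n y) (k x y)

theorem HasFeatures.rankOne (f : X → ℝ) : HasFeatures fun x y => f x * f y :=
  ⟨Unit, fun _ => f, fun x y => hasSum_unique fun _ : Unit => f x * f y⟩

theorem HasFeatures.zero : HasFeatures fun _ _ : X => (0 : ℝ) := by
  simpa using HasFeatures.rankOne fun _ : X => (0 : ℝ)

theorem HasFeatures.one : HasFeatures fun _ _ : X => (1 : ℝ) := by
  simpa using HasFeatures.rankOne fun _ : X => (1 : ℝ)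

theorem HasFeatures.add {k l : X → X → ℝ} (hk : HasFeatures k) (hl : HasFeatures l) :
    HasFeatures fun x y => k x y + l x y := by
  obtain ⟨ι, f, hf⟩ := hk
  obtain ⟨κ, g, hg⟩ := hl
  refine ⟨ι ⊕ κ, Sum.elim f g, fun x y => ?_⟩
  exact HasSum.sum (f := fun n => Sum.elim f g n x * Sum.elim f g n y) (hf x y) (hg x y)

theorem HasFeatures.mul {k l : X → X → ℝ} (hk : HasFeatures k) (hl : HasFeatures l) :
    HasFeatures fun x y => k x y * l x y := by
  obtain ⟨ι, f, hf⟩ := hk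
  obtain ⟨κ, g, hg⟩ := hl
  refine ⟨ι × κ, fun n x => f n.1 x * g n.2 x, fun x y => ?_⟩
  have h := (hf x y).mul (hg x y)
    (summable_mul_of_summable_norm (hf x y).summable.norm (hg x y).summable.norm)
  refine h.congr_fun ?_
  intro n
  ring

theorem HasFeatures.const_mul {k : X → X → ℝ} (hk : HasFeatures k) {c : ℝ} (hc : 0 ≤ c) :
    HasFeatures fun x y => c * k x y := by
  have h := (HasFeatures.rankOne fun _ : X => √c).mul hk
  simpa [Real.mul_self_sqrt hc] using h

theorem HasFeatures.sum {ι : Type} (s : Finset ι) {k : ι → X → X → ℝ}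
    (hk : ∀ i ∈ s, HasFeatures (k i)) : HasFeatures fun x y => ∑ i ∈ s, k i x y := by
  classical
  induction s using Finset.induction_on with
  | empty => simpa using HasFeatures.zero
  | insert i s hi ih =>
    simp only [Finset.sum_insert hi]
    exact (hk i (by simp)).add (ih fun j hj => hk j (by simp [hj]))

theorem HasFeatures.prod {ι : Type} (s : Finset ι) {k : ι → X → X → ℝ}
    (hk : ∀ i ∈ s, HasFeatures (k i)) : HasFeatures fun x y => ∏ i ∈ s, k i x y := by
  classical
  induction s using Finset.induction_on with
  | empty => simpa using HasFeatures.one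
  | insert i s hi ih =>
    simp only [Finset.prod_insert hi]
    exact (hk i (by simp)).mul (ih fun j hj => hk j (by simp [hj]))

theorem HasFeatures.comp {Y : Type} {k : X → X → ℝ} (hk : HasFeatures k) (p : Y → X) :
    HasFeatures fun x y => k (p x) (p y) := by
  obtain ⟨ι, f, hf⟩ := hk
  exact ⟨ι, fun n x => f n (p x), fun x y => hf (p x) (p y)⟩

/-- A convergent nonnegative combination of cosine kernels. -/
theorem HasFeatures.cos {ι : Type} {k : X → X → ℝ} (a : ι → ℝ) (ha : ∀ n, 0 ≤ a n)
    (t : ι → X → ℝ) (hs : Summable a)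
    (h : ∀ x y, HasSum (fun n => a n * Real.cos (t n x - t n y)) (k x y)) : HasFeatures k := by
  refine ⟨ι ⊕ ι, Sum.elim (fun n x => √(a n) * Real.cos (t n x))
    (fun n x => √(a n) * Real.sin (t n x)), fun x y => ?_⟩
  have hc : Summable fun n => √(a n) * Real.cos (t n x) * (√(a n) * Real.cos (t n y)) := by
    refine hs.of_norm_bounded fun n => ?_
    rw [show √(a n) * Real.cos (t n x) * (√(a n) * Real.cos (t n y))
      = (√(a n) * √(a n)) * (Real.cos (t n x) * Real.cos (t n y)) by ring,
      Real.mul_self_sqrt (ha n), norm_mul, norm_mul, Real.norm_of_nonneg (ha n)]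
    exact mul_le_of_le_one_right (ha n)
      (mul_le_one₀ (Real.abs_cos_le_one _) (norm_nonneg _) (Real.abs_cos_le_one _))
  have hsn : Summable fun n => √(a n) * Real.sin (t n x) * (√(a n) * Real.sin (t n y)) := by
    refine hs.of_norm_bounded fun n => ?_
    rw [show √(a n) * Real.sin (t n x) * (√(a n) * Real.sin (t n y))
      = (√(a n) * √(a n)) * (Real.sin (t n x) * Real.sin (t n y)) by ring,
      Real.mul_self_sqrt (ha n), norm_mul, norm_mul, Real.norm_of_nonneg (ha n)]
    exact mul_le_of_le_one_right (ha n)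
      (mul_le_one₀ (Real.abs_sin_le_one _) (norm_nonneg _) (Real.abs_sin_le_one _))
  have key : k x y = (∑' n, √(a n) * Real.cos (t n x) * (√(a n) * Real.cos (t n y)))
      + ∑' n, √(a n) * Real.sin (t n x) * (√(a n) * Real.sin (t n y)) := by
    rw [← hc.tsum_add hsn, ← (h x y).tsum_eq]
    refine tsum_congr fun n => ?_
    rw [Real.cos_sub]
    linear_combination (-(Real.cos (t n x) * Real.cos (t n y))
      - Real.sin (t n x) * Real.sin (t n y)) * Real.mul_self_sqrt (ha n)
  rw [key]
  exact HasSum.sum (f := fun n => Sum.elim (fun n x => √(a n) * Real.cos (t n x))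
    (fun n x => √(a n) * Real.sin (t n x)) n x * Sum.elim (fun n x => √(a n) * Real.cos (t n x))
    (fun n x => √(a n) * Real.sin (t n x)) n y) hc.hasSum hsn.hasSum

theorem HasFeatures.posSemidef {k : X → X → ℝ} (hk : HasFeatures k) :
    (kernelMatrix k).PosSemidef := by
  obtain ⟨ι, f, hf⟩ := hk
  have iff := (RKHS.posSemidef_tfae (K := kernelMatrix k)).out 0 2
  refine iff.mpr ⟨?_, fun v => ?_⟩
  · ext x y
    have : k x y = k y x := (hf x y).unique (by simpa [mul_comm] using hf y x)
    simp [kernelMatrix, this, show ContinuousLinearMap.id ℝ ℝ = 1 from rfl]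
  · have h : HasSum (fun n => (v.sum fun x w => w * f n x) ^ 2)
        (v.sum fun x w => v.sum fun x' w' => inner ℝ (kernelMatrix k x' x w) w') := by
      have h1 : HasSum (fun n => ∑ x ∈ v.support, ∑ x' ∈ v.support,
          v x * v x' * (f n x' * f n x))
          (∑ x ∈ v.support, ∑ x' ∈ v.support, v x * v x' * k x' x) :=
        hasSum_sum fun x _ => hasSum_sum fun x' _ => (hf x' x).mul_left _
      convert h1 using 1
      · funext n
        simp only [Finsupp.sum, sq, Finset.sum_mul_sum]
        exact Finset.sum_congr rfl fun x _ => Finset.sum_congr rfl fun x' _ => by ring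
      · simp only [Finsupp.sum]
        refine Finset.sum_congr rfl fun x _ => Finset.sum_congr rfl fun x' _ => ?_
        simp [kernelMatrix]
        ring
    exact h.nonneg fun n => sq_nonneg _

end Kernels

/-! ### The function spaces -/

/-- The unit cube `[0,1]^s`. -/
abbrev Cube (s : ℕ) : Type := Fin s → I

/-- A family of weights `γ_u ≥ 0`, indexed by the subsets `u` of the coordinates. -/
abbrev Weights (s : ℕ) : Type := Finset (Fin s) → ℝ≥0

/-- The function `r_{α,γ,s}` on `ℤ^s`: it is `1` at `0`, and `γ_u ∏_{j ∈ u} |h_j|^{-2α}` at a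
vector `h ≠ 0` with support `u`. -/
def korobovCoeff {s : ℕ} (α : ℝ) (γ : Weights s) (h : Fin s → ℤ) : ℝ :=
  if h = 0 then 1
  else γ {j | h j ≠ 0} * ∏ j with h j ≠ 0, |(h j : ℝ)| ^ (-2 * α)

/-- The kernel of the weighted Korobov space,
`∑_{h ∈ ℤ^s} r_{α,γ,s}(h) exp(2πi h·(x - y))`; the sum is real, since `r(-h) = r(h)`. -/
def korobovKernel {s : ℕ} (α : ℝ) (γ : Weights s) (x y : Cube s) : ℝ :=
  (∑' h : Fin s → ℤ, (korobovCoeff α γ h : ℂ) *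
    Complex.exp (2 * Real.pi * Complex.I * ∑ j, (h j : ℂ) * ((x j : ℝ) - (y j : ℝ) : ℝ))).re

/-- The unweighted univariate kernel of the non-periodic Sobolev space of order `α`. -/
def sobolevKernel₁ (α : ℕ) (x y : I) : ℝ :=
  1 + ∑ τ ∈ Finset.Icc 1 α, bernoulliFun τ x * bernoulliFun τ y / (τ.factorial : ℝ) ^ 2
    + (-1) ^ (α + 1) * bernoulliFun (2 * α) |(x : ℝ) - y| / ((2 * α).factorial : ℝ)

/-- The kernel of the weighted non-periodic Sobolev space of order `α`. -/
def sobolevKernel {s : ℕ} (α : ℕ) (γ : Weights s) (x y : Cube s) : ℝ :=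
  1 + ∑ u : Finset (Fin s) with u.Nonempty,
    γ u * ∏ j ∈ u, (-1 + sobolevKernel₁ α (x j) (y j))

theorem korobovCoeff_nonneg {s : ℕ} (α : ℝ) (γ : Weights s) (h : Fin s → ℤ) :
    0 ≤ korobovCoeff α γ h := by
  unfold korobovCoeff
  split_ifs <;> positivity

theorem korobovKernel_term_norm {s : ℕ} (α : ℝ) (γ : Weights s) (x y : Cube s)
    (h : Fin s → ℤ) :
    ‖(korobovCoeff α γ h : ℂ) *
      Complex.exp (2 * Real.pi * Complex.I * ∑ j, (h j : ℂ) * ((x j : ℝ) - (y j : ℝ) : ℝ))‖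
      = korobovCoeff α γ h := by
  have : (2 * Real.pi * Complex.I * ∑ j, (h j : ℂ) * ((x j : ℝ) - (y j : ℝ) : ℝ) : ℂ)
      = ((2 * Real.pi * ∑ j, (h j : ℝ) * ((x j : ℝ) - (y j : ℝ)) : ℝ) : ℂ) * Complex.I := by
    push_cast
    ring
  rw [norm_mul, this, Complex.norm_exp_ofReal_mul_I, mul_one, Complex.norm_real,
    Real.norm_of_nonneg (korobovCoeff_nonneg α γ h)]

theorem korobovKernel_hasFeatures {s : ℕ} (α : ℝ) (γ : Weights s) :
    HasFeatures (korobovKernel α γ) := by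
  by_cases hs : Summable (korobovCoeff α γ)
  · refine HasFeatures.cos (korobovCoeff α γ) (korobovCoeff_nonneg α γ)
      (fun h x => 2 * Real.pi * ∑ j, (h j : ℝ) * (x j : ℝ)) hs fun x y => ?_
    have hsum : Summable fun h : Fin s → ℤ => (korobovCoeff α γ h : ℂ) *
        Complex.exp (2 * Real.pi * Complex.I *
          ∑ j, (h j : ℂ) * ((x j : ℝ) - (y j : ℝ) : ℝ)) := by
      refine Summable.of_norm ?_
      simpa only [korobovKernel_term_norm] using hs
    have h := Complex.hasSum_re hsum.hasSum
    refine h.congr_fun fun n => ?_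
    have : (2 * Real.pi * Complex.I * ∑ j, (n j : ℂ) * ((x j : ℝ) - (y j : ℝ) : ℝ) : ℂ)
        = ((2 * Real.pi * ∑ j, (n j : ℝ) * (x j : ℝ) - 2 * Real.pi * ∑ j, (n j : ℝ) * (y j : ℝ)
          : ℝ) : ℂ) * Complex.I := by
      rw [← mul_sub, ← Finset.sum_sub_distrib]
      simp only [← mul_sub]
      push_cast
      ring
    rw [this, Complex.re_ofReal_mul, Complex.exp_ofReal_mul_I_re]
  · have : korobovKernel α γ = fun _ _ => 0 := by
      funext x y
      unfold korobovKernel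
      rw [tsum_eq_zero_of_not_summable, Complex.zero_re]
      intro hc
      refine hs ?_
      simpa only [korobovKernel_term_norm] using hc.norm
    rw [this]
    exact HasFeatures.zero

theorem sobolevKernel₁_hasFeatures (α : ℕ) (hα : α ≠ 0) :
    HasFeatures fun x y : I => -1 + sobolevKernel₁ α x y := by
  have h1 : HasFeatures fun x y : I => ∑ τ ∈ Finset.Icc 1 α,
      (bernoulliFun τ x / (τ.factorial : ℝ)) * (bernoulliFun τ y / (τ.factorial : ℝ)) :=
    HasFeatures.sum _ fun τ _ => HasFeatures.rankOne _
  have h2 : HasFeatures fun x y : I => (2 / (2 * Real.pi) ^ (2 * α)) *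
      ((-1 : ℝ) ^ (α + 1) * (2 * Real.pi) ^ (2 * α) / 2 / (2 * α).factorial *
        bernoulliFun (2 * α) |(x : ℝ) - y|) := by
    refine HasFeatures.const_mul ?_ (by positivity)
    refine HasFeatures.cos (fun n : ℕ => 1 / (n : ℝ) ^ (2 * α)) (fun n => by positivity)
      (fun n x => 2 * Real.pi * n * x) (Real.summable_one_div_nat_pow.mpr (by omega))
      fun x y => ?_
    have hx : |(x : ℝ) - y| ∈ Set.Icc (0 : ℝ) 1 :=
      ⟨abs_nonneg _, abs_le.mpr ⟨by linarith [x.2.1, y.2.2], by linarith [x.2.2, y.2.1]⟩⟩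
    refine (hasSum_one_div_nat_pow_mul_cos hα hx).congr_fun fun n => ?_
    rw [← mul_sub, ← Real.cos_abs (2 * Real.pi * n * ((x : ℝ) - y)), abs_mul,
      abs_of_nonneg (by positivity : 0 ≤ 2 * Real.pi * (n : ℝ))]
  convert h1.add h2 using 3 with x y
  have hpi : (2 * Real.pi) ^ (2 * α) ≠ 0 := by positivity
  have hf : ((2 * α).factorial : ℝ) ≠ 0 := by positivity
  unfold sobolevKernel₁
  have e1 : ∀ τ ∈ Finset.Icc 1 α, bernoulliFun τ x * bernoulliFun τ y / (τ.factorial : ℝ) ^ 2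
      = (bernoulliFun τ x / (τ.factorial : ℝ)) * (bernoulliFun τ y / (τ.factorial : ℝ)) :=
    fun τ _ => by rw [div_mul_div_comm, sq]
  rw [Finset.sum_congr rfl e1, add_assoc, neg_add_cancel_left]
  congr 1
  field_simp

theorem sobolevKernel_hasFeatures {s : ℕ} (α : ℕ) (hα : α ≠ 0) (γ : Weights s) :
    HasFeatures (sobolevKernel α γ) :=
  HasFeatures.one.add <| HasFeatures.sum _ fun u _ =>
    HasFeatures.const_mul (HasFeatures.prod _ fun j _ =>
      (sobolevKernel₁_hasFeatures α hα).comp fun x : Cube s => x j) (γ u).coe_nonneg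

instance factKorobov {s : ℕ} (α : ℝ) (γ : Weights s) :
    Fact (kernelMatrix (korobovKernel α γ)).PosSemidef :=
  ⟨(korobovKernel_hasFeatures α γ).posSemidef⟩

instance factSobolev {s : ℕ} (α : ℕ) [NeZero α] (γ : Weights s) :
    Fact (kernelMatrix (sobolevKernel α γ)).PosSemidef :=
  ⟨(sobolevKernel_hasFeatures α (NeZero.ne α) γ).posSemidef⟩

/-- The weighted Korobov space: the Hilbert space of real functions on `[0,1]^s` with
reproducing kernel `korobovKernel α γ` (smoothness `α > 1/2`). -/
abbrev KorobovSpace {s : ℕ} (α : ℝ) (γ : Weights s) : Type :=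
  RKHS.OfKernel (kernelMatrix (korobovKernel α γ))

/-- The weighted non-periodic Sobolev space: the Hilbert space of real functions on `[0,1]^s`
with reproducing kernel `sobolevKernel α γ` (order `α ≥ 1`). -/
abbrev SobolevSpace {s : ℕ} (α : ℕ) [NeZero α] (γ : Weights s) : Type :=
  RKHS.OfKernel (kernelMatrix (sobolevKernel α γ))

/-! ### Worst-case errors of quasi-Monte Carlo rules -/

/-- The quasi-Monte Carlo rule of a finite point multiset `P`. -/
def qmc {s : ℕ} (P : Multiset (Cube s)) (f : Cube s → ℝ) : ℝ :=
  (P.map f).sum / P.card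

/-- The worst-case error in the unit ball of a Hilbert space `H` of functions on `[0,1]^s`. -/
def worstCaseError {s : ℕ} (H : Type) [NormedAddCommGroup H] [InnerProductSpace ℝ H]
    [RKHS ℝ H (Cube s) ℝ] (P : Multiset (Cube s)) : ℝ≥0∞ :=
  ⨆ (f : H) (_ : ‖f‖ ≤ 1), ENNReal.ofReal |qmc P f - ∫ x : Cube s, f x|

/-! ### Lattice rules -/

/-- The fractional part, as a point of `[0,1]`. -/
def fractI (t : ℝ) : I := ⟨Int.fract t, Int.fract_nonneg t, (Int.fract_lt_one t).le⟩

/-- The rank-1 lattice point multiset with `N` points and generating vector `z`. -/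
def latticePoints {s : ℕ} (N : ℕ) (z : Fin s → ℕ) : Multiset (Cube s) :=
  (Multiset.range N).map fun n j => fractI ((n : ℝ) * (z j : ℝ) / (N : ℝ))

/-- The tent transformation `φ(x) = 1 - |2x - 1|`. -/
def tent (x : I) : I :=
  ⟨1 - |2 * (x : ℝ) - 1|, by
    rw [sub_nonneg, abs_le]
    constructor <;> linarith [x.2.1, x.2.2], by linarith [abs_nonneg (2 * (x : ℝ) - 1)]⟩

/-- The tent-transformed rank-1 lattice point multiset. -/
def tentLatticePoints {s : ℕ} (N : ℕ) (z : Fin s → ℕ) : Multiset (Cube s) :=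
  (latticePoints N z).map fun x j => tent (x j)

/-! ### The component-by-component algorithm -/

/-- The weights of the subsets of the first `d` coordinates. -/
def restrictWeights {s d : ℕ} (hd : d ≤ s) (γ : Weights s) : Weights d :=
  fun u => γ (u.map (Fin.castLEEmb hd))

/-- The constant `c' = 58/3`. -/
def cPrime : ℝ≥0 := 58 / 3

/-- The weights `γ'^{1/2}`, where `γ'_u = γ_u (c'/(4π⁴))^{|u|}`. -/
def sqrtModifiedWeights {s : ℕ} (γ : Weights s) : Weights s :=
  fun u => NNReal.sqrt (γ u * (cPrime / (4 * NNReal.pi ^ 4)) ^ u.card)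

/-- `z` is an output of the component-by-component algorithm with quality criterion `crit`
(where `crit d z` is the criterion for `d`-dimensional vectors, `d ≤ s`): for
`d = 0, …, s - 1`, with the first `d` components already chosen and kept fixed, the next
component is a value in `{1, …, N - 1}` which minimizes the criterion in dimension `d + 1`.
Ties may be broken in any way. -/
def IsCBCOutput {s : ℕ} (N : ℕ) (crit : (d : ℕ) → d ≤ s → (Fin d → ℕ) → ℝ≥0∞)
    (z : Fin s → ℕ) : Prop :=
  ∀ (d : ℕ) (hd : d < s),
    z ⟨d, hd⟩ ∈ Finset.Icc 1 (N - 1) ∧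
    ∀ c ∈ Finset.Icc 1 (N - 1),
      crit (d + 1) hd (Fin.snoc (fun j => z (Fin.castLE hd.le j)) (z ⟨d, hd⟩)) ≤
        crit (d + 1) hd (Fin.snoc (fun j => z (Fin.castLE hd.le j)) c)

/-- The criterion: the squared worst-case error of the lattice rule in the `d`-dimensional
Korobov space of smoothness `1` with the weights `γ'^{1/2}`. -/
def korobovCriterion {s : ℕ} (γ : Weights s) (N d : ℕ) (hd : d ≤ s) (z : Fin d → ℕ) : ℝ≥0∞ :=
  worstCaseError (KorobovSpace 1 (restrictWeights hd (sqrtModifiedWeights γ)))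
    (latticePoints N z) ^ 2


end TentLattice

end

open TentLattice

/-! Everything passes through one quantity, `dualSum`: the sum of the Korobov coefficients r(h),
with smoothness 1 and weights `sqrtModifiedWeights γ`, over the nonzero h in the dual lattice, i.e.
with N ∣ h·z.

The squared Korobov error equals it (`worstCaseError_korobovSpace_sq`): the squared norm of the
error representer is a double mean of the kernel minus 1, and averaging characters over a lattice
keeps exactly the dual vectors.

The Sobolev error is at most the same sum (`worstCaseError_tentLatticePoints_le`). For f in the unit
ball, f ∘ tent is continuous on the torus. Its Fourier coefficient at h is a bounded functional of
f, and the squared norm of the representer is a double Fourier integral of the kernel. This factors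
into diagonal cosine coefficients of the univariate kernel, each at most (29/6)/(πh_j)^4, so
|coefficient| ≤ r(h) (`norm_integral_mFourier_mul_le`); c' and the square root of the weights are
chosen to make this exact. Hence the Fourier series converges absolutely, and the rule's error is
the sum of its coefficients over the nonzero dual vectors.

For the algorithm, `dualSum` is split by the last nonzero index i of h. The part `lastSum` at i
depends only on the components up to i, and it is all that the choice of z_i can influence, so z_i
minimizes it. The minimum is at most the average over candidates; Jensen's inequality with exponent
λ and a count of the solutions of a linear congruence modulo the prime N bound that average
(`sum_lastSum_update_le`). The sum of r(h)^λ over all h ≠ 0 then factors into powers of 2ζ(2λ). The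
rate N^(-2+ε) follows by taking λ close to 1/2. -/

noncomputable section

namespace TentLattice

/-! ### Representers of functionals in a reproducing kernel Hilbert space -/

section Representers

variable {X H : Type} [NormedAddCommGroup H] [InnerProductSpace ℝ H] [CompleteSpace H]
  [RKHS ℝ H X ℝ]

/-- The representer of point evaluation. -/
def evalRep (H : Type) [NormedAddCommGroup H] [InnerProductSpace ℝ H] [CompleteSpace H]
    [RKHS ℝ H X ℝ] (x : X) : H := RKHS.kerFun H x (1 : ℝ)

theorem inner_evalRep (f : H) (x : X) : inner ℝ f (evalRep H x) = f x := by
  simp [evalRep]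

theorem evalRep_apply (x y : X) : evalRep H y x = RKHS.kernel H x y 1 :=
  RKHS.kerFun_apply H y 1 x

variable [TopologicalSpace X]

/-- The squared distance between two representers expands into kernel values only, and these cancel
on the diagonal. Continuity makes the vector-valued integrals of representers below well behaved. -/
theorem continuous_evalRep
    (hk : Continuous fun p : X × X => RKHS.kernel H p.1 p.2 (1 : ℝ)) :
    Continuous (evalRep H : X → H) := by
  rw [continuous_iff_continuousAt]
  intro x
  rw [ContinuousAt, tendsto_iff_norm_sub_tendsto_zero]
  have h2 : Filter.Tendsto (fun y => ‖evalRep H y - evalRep H x‖ ^ 2) (nhds x) (nhds 0) := by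
    have e : ∀ y, ‖evalRep H y - evalRep H x‖ ^ 2 = RKHS.kernel H y y (1 : ℝ)
        - 2 * RKHS.kernel H x y (1 : ℝ) + RKHS.kernel H x x (1 : ℝ) := by
      intro y
      rw [norm_sub_sq_real, ← real_inner_self_eq_norm_sq, ← real_inner_self_eq_norm_sq,
        inner_evalRep, inner_evalRep, inner_evalRep, evalRep_apply, evalRep_apply, evalRep_apply]
    simp only [e]
    have c : Continuous fun y => RKHS.kernel H y y (1 : ℝ)
        - 2 * RKHS.kernel H x y (1 : ℝ) + RKHS.kernel H x x (1 : ℝ) := by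
      have h1 := hk.comp (continuous_id.prodMk continuous_id)
      have h2 := hk.comp (Continuous.prodMk_right x)
      exact (h1.sub (h2.const_smul (2 : ℝ))).add continuous_const
    have := c.tendsto x
    simpa [two_mul] using this
  have h3 := h2.sqrt
  simpa using h3

theorem continuous_of_continuous_kernel
    (hk : Continuous fun p : X × X => RKHS.kernel H p.1 p.2 (1 : ℝ)) (f : H) :
    Continuous fun x => f x := by
  simp only [← inner_evalRep]
  exact continuous_const.inner (continuous_evalRep hk)

variable {Y : Type} [TopologicalSpace Y] [CompactSpace Y] [MeasurableSpace Y] [BorelSpace Y]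
  (μ : Measure Y) [IsFiniteMeasure μ]

theorem integrable_of_continuous {E : Type*} [NormedAddCommGroup E] {g : Y → E}
    (hg : Continuous g) : Integrable g μ :=
  hg.integrable_of_hasCompactSupport (HasCompactSupport.of_compactSpace g)

/-- The representer of the functional `f ↦ ∫ g y * f (p y) ∂μ`. -/
def integralRep (H : Type) [NormedAddCommGroup H] [InnerProductSpace ℝ H] [CompleteSpace H]
    [RKHS ℝ H X ℝ] (p : Y → X) (g : Y → ℝ) : H := ∫ y, g y • evalRep H (p y) ∂μ

theorem inner_integralRep
    (hk : Continuous fun p : X × X => RKHS.kernel H p.1 p.2 (1 : ℝ)) {p : Y → X}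
    (hp : Continuous p) {g : Y → ℝ} (hg : Continuous g) (f : H) :
    inner ℝ f (integralRep μ H p g) = ∫ y, g y * f (p y) ∂μ := by
  have hi : Integrable (fun y => g y • evalRep H (p y)) μ :=
    integrable_of_continuous μ (hg.smul ((continuous_evalRep hk).comp hp))
  rw [integralRep, ← integral_inner hi]
  simp only [real_inner_smul_right, inner_evalRep]

theorem integralRep_apply
    (hk : Continuous fun p : X × X => RKHS.kernel H p.1 p.2 (1 : ℝ)) {p : Y → X}
    (hp : Continuous p) {g : Y → ℝ} (hg : Continuous g) (x : X) :
    integralRep μ H p g x = ∫ y, g y * RKHS.kernel H (p y) x 1 ∂μ := by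
  rw [← inner_evalRep, real_inner_comm, inner_integralRep μ hk hp hg]
  simp only [evalRep_apply]

/-- This is how norms of Fourier coefficient functionals become double integrals of the kernel. -/
theorem norm_sq_integralRep
    (hk : Continuous fun p : X × X => RKHS.kernel H p.1 p.2 (1 : ℝ)) {p : Y → X}
    (hp : Continuous p) {g : Y → ℝ} (hg : Continuous g) :
    ‖integralRep μ H p g‖ ^ 2
      = ∫ x, ∫ y, g x * g y * RKHS.kernel H (p y) (p x) 1 ∂μ ∂μ := by
  rw [← real_inner_self_eq_norm_sq, inner_integralRep μ hk hp hg]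
  refine integral_congr_ae (Filter.Eventually.of_forall fun x => ?_)
  simp only [integralRep_apply μ hk hp hg, ← integral_const_mul, mul_assoc]

end Representers

/-- The supremum defining the worst-case error is attained at the representer of the error. -/
theorem worstCaseError_eq_norm {s : ℕ} {H : Type} [NormedAddCommGroup H] [InnerProductSpace ℝ H]
    [RKHS ℝ H (Cube s) ℝ] {P : Multiset (Cube s)} {ξ : H}
    (hξ : ∀ f : H, qmc P f - ∫ x : Cube s, f x = inner ℝ f ξ) :
    worstCaseError H P = ENNReal.ofReal ‖ξ‖ := by
  refine le_antisymm (iSup₂_le fun f hf => ENNReal.ofReal_le_ofReal ?_) ?_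
  · rw [hξ]
    refine (abs_real_inner_le_norm f ξ).trans ?_
    exact mul_le_of_le_one_left (norm_nonneg _) hf
  · rcases eq_or_ne ξ 0 with h0 | h0
    · simp [h0]
    have hn : ‖ξ‖ ≠ 0 := norm_ne_zero_iff.mpr h0
    have h1 : ‖(‖ξ‖⁻¹ • ξ)‖ ≤ 1 := by rw [norm_smul, norm_inv, norm_norm, inv_mul_cancel₀ hn]
    refine le_trans ?_ (le_iSup₂_of_le (f := fun (f : H) (_ : ‖f‖ ≤ 1) =>
      ENNReal.ofReal |qmc P f - ∫ x : Cube s, f x|) (‖ξ‖⁻¹ • ξ) h1 le_rfl)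
    refine ENNReal.ofReal_le_ofReal ?_
    rw [hξ, real_inner_smul_left, real_inner_self_eq_norm_sq]
    rw [sq, inv_mul_cancel_left₀ hn]
    exact le_abs_self _

/-! ### Sums of Korobov coefficients -/

/-- In `ℝ≥0∞` sums may be rearranged freely, so the coordinates split off one at a time without any
summability condition. -/
theorem tsum_pi_prod {n : ℕ} (g : Fin n → ℤ → ℝ≥0∞) :
    ∑' h : Fin n → ℤ, ∏ j, g j (h j) = ∏ j, ∑' k, g j k := by
  induction n with
  | zero => simp [tsum_fintype]
  | succ n ih =>
    rw [← (Fin.consEquiv fun _ : Fin (n + 1) => ℤ).tsum_eq, ENNReal.tsum_prod', Fin.prod_univ_succ]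
    simp only [Fin.consEquiv_apply, Fin.prod_univ_succ, Fin.cons_zero, Fin.cons_succ]
    simp only [ENNReal.tsum_mul_left, ih, ENNReal.tsum_mul_right]

/-- The sum `∑_{k ≠ 0} |k|^{-2l}`. -/
def bilateralZeta (l : ℝ) : ℝ≥0∞ :=
  ∑' k : ℤ, if k = 0 then 0 else ENNReal.ofReal (|(k : ℝ)| ^ (-2 * l))

theorem riemannZeta_re_eq_tsum {l : ℝ} (hl : 1 / 2 < l) :
    (riemannZeta (2 * (l : ℂ))).re = ∑' n : ℕ, 1 / (n : ℝ) ^ (2 * l) := by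
  rw [zeta_eq_tsum_one_div_nat_cpow (by simp; linarith)]
  have : ∀ n : ℕ, (1 / (n : ℂ) ^ (2 * (l : ℂ))) = ((1 / (n : ℝ) ^ (2 * l) : ℝ) : ℂ) := by
    intro n
    push_cast
    rw [Complex.ofReal_cpow (by positivity)]
    push_cast
    rfl
  simp only [this]
  rw [← Complex.ofReal_tsum, Complex.ofReal_re]

theorem riemannZeta_re_nonneg {l : ℝ} (hl : 1 / 2 < l) :
    0 ≤ (riemannZeta (2 * (l : ℂ))).re := by
  rw [riemannZeta_re_eq_tsum hl]
  exact tsum_nonneg fun n => by positivity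

theorem bilateralZeta_eq {l : ℝ} (hl : 1 / 2 < l) :
    bilateralZeta l = ENNReal.ofReal (2 * (riemannZeta (2 * (l : ℂ))).re) := by
  have hs : Summable fun n : ℕ => 1 / (n : ℝ) ^ (2 * l) :=
    Real.summable_one_div_nat_rpow.mpr (by linarith)
  have hl0 : 2 * l ≠ 0 := by linarith
  have hn : ∑' n : ℕ, ENNReal.ofReal (1 / ((n + 1 : ℕ) : ℝ) ^ (2 * l))
      = ENNReal.ofReal (riemannZeta (2 * (l : ℂ))).re := by
    -- The term n = 0 contributes nothing: 0^(2l) = 0 and division by zero gives 0.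
    rw [riemannZeta_re_eq_tsum hl, hs.tsum_eq_zero_add, Nat.cast_zero, Real.zero_rpow hl0, div_zero, zero_add,
      ENNReal.ofReal_tsum_of_nonneg (fun n => by positivity) ((summable_nat_add_iff 1).mpr hs)]
  have hzero := riemannZeta_re_nonneg hl
  rw [bilateralZeta, tsum_of_add_one_of_neg_add_one ENNReal.summable ENNReal.summable]
  have e1 : ∀ n : ℕ, (if ((n : ℤ) + 1) = 0 then 0
      else ENNReal.ofReal (|(((n : ℤ) + 1 : ℤ) : ℝ)| ^ (-2 * l)))
      = ENNReal.ofReal (1 / ((n + 1 : ℕ) : ℝ) ^ (2 * l)) := by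
    intro n
    rw [if_neg (by omega)]
    congr 1
    push_cast
    rw [abs_of_nonneg (by positivity), neg_mul, Real.rpow_neg (by positivity), one_div]
  have e2 : ∀ n : ℕ, (if (-((n : ℤ) + 1)) = 0 then 0
      else ENNReal.ofReal (|((-((n : ℤ) + 1) : ℤ) : ℝ)| ^ (-2 * l)))
      = ENNReal.ofReal (1 / ((n + 1 : ℕ) : ℝ) ^ (2 * l)) := by
    intro n
    rw [if_neg (by omega), Int.cast_neg, abs_neg, ← e1, if_neg (by omega)]
  simp only [e1, e2, hn, if_true, add_zero]
  rw [← ENNReal.ofReal_add hzero hzero, two_mul (riemannZeta _).re]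

theorem bilateralZeta_ne_top {l : ℝ} (hl : 1 / 2 < l) : bilateralZeta l ≠ ∞ := by
  rw [bilateralZeta_eq hl]
  exact ENNReal.ofReal_ne_top

theorem ofReal_korobovCoeff_rpow {s : ℕ} (w : Weights s) {l : ℝ} (hl : 0 < l)
    {h : Fin s → ℤ} (hh : h ≠ 0) :
    ENNReal.ofReal (korobovCoeff 1 w h) ^ l
      = (w {j | h j ≠ 0} : ℝ≥0∞) ^ l
        * ∏ j with h j ≠ 0, ENNReal.ofReal (|(h j : ℝ)| ^ (-2 * l)) := by
  rw [korobovCoeff, if_neg hh, ENNReal.ofReal_mul (by positivity), ENNReal.ofReal_coe_nnreal,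
    ENNReal.mul_rpow_of_nonneg _ _ hl.le, ENNReal.ofReal_prod_of_nonneg (fun _ _ => by positivity),
    ← ENNReal.prod_rpow_of_nonneg hl.le]
  congr 1
  refine Finset.prod_congr rfl fun j _ => ?_
  rw [ENNReal.ofReal_rpow_of_nonneg (by positivity) hl.le, ← Real.rpow_mul (abs_nonneg _)]
  congr 2
  ring

/-- A vector h ≠ 0 belongs to exactly one support u. The product of the factors `G u j` vanishes
unless the support of h is u, so the restriction to a given support becomes a product over
coordinates and `tsum_pi_prod` applies. -/
theorem tsum_korobovCoeff_rpow {s : ℕ} (w : Weights s) {l : ℝ} (hl : 0 < l) :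
    ∑' h : Fin s → ℤ, (if h = 0 then 0 else ENNReal.ofReal (korobovCoeff 1 w h) ^ l)
      = ∑ u : Finset (Fin s) with u.Nonempty, (w u : ℝ≥0∞) ^ l * bilateralZeta l ^ u.card := by
  classical
  let G : Finset (Fin s) → Fin s → ℤ → ℝ≥0∞ := fun u j k =>
    if j ∈ u then (if k = 0 then 0 else ENNReal.ofReal (|(k : ℝ)| ^ (-2 * l)))
    else if k = 0 then 1 else 0
  have hG : ∀ u : Finset (Fin s), ∑' h : Fin s → ℤ, ∏ j, G u j (h j) = bilateralZeta l ^ u.card := by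
    intro u
    rw [tsum_pi_prod]
    have : ∀ j, ∑' k, G u j k = if j ∈ u then bilateralZeta l else 1 := by
      intro j
      by_cases hj : j ∈ u
      · simp [G, hj, bilateralZeta]
      · simp only [G, hj, if_false]
        exact tsum_ite_eq 0 _
    simp only [this, Finset.prod_ite_mem, Finset.univ_inter, Finset.prod_const]
  have hterm : ∀ h : Fin s → ℤ, (if h = 0 then 0 else ENNReal.ofReal (korobovCoeff 1 w h) ^ l)
      = ∑ u : Finset (Fin s) with u.Nonempty, (w u : ℝ≥0∞) ^ l * ∏ j, G u j (h j) := by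
    intro h
    have hz : ∀ u : Finset (Fin s), u ≠ ({j | h j ≠ 0} : Finset (Fin s)) →
        ∏ j, G u j (h j) = 0 := by
      intro u hu
      have : ∃ j, ¬ (j ∈ u ↔ h j ≠ 0) := by
        by_contra hc
        push Not at hc
        exact hu (by ext j; simpa using hc j)
      obtain ⟨j, hj⟩ := this
      refine Finset.prod_eq_zero (Finset.mem_univ j) ?_
      by_cases hju : j ∈ u <;> by_cases h0 : h j = 0 <;> simp_all [G]
    split_ifs with h0
    · symm
      refine Finset.sum_eq_zero fun u hu => ?_
      rw [hz u, mul_zero]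
      rintro rfl
      simp [h0] at hu
    · rw [ofReal_korobovCoeff_rpow w hl h0,
        Finset.sum_eq_single_of_mem ({j | h j ≠ 0} : Finset (Fin s))]
      · congr 1
        rw [Finset.prod_filter]
        refine Finset.prod_congr rfl fun j _ => ?_
        by_cases hj : h j = 0 <;> simp [G, hj]
      · simp only [Finset.mem_filter, Finset.mem_univ, true_and]
        obtain ⟨j, hj⟩ := Function.ne_iff.mp h0
        exact ⟨j, by simpa using hj⟩
      · intro u _ hu
        rw [hz u hu, mul_zero]
  simp only [hterm]
  rw [Summable.tsum_finsetSum fun _ _ => ENNReal.summable]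
  simp only [ENNReal.tsum_mul_left, hG]

theorem summable_korobovCoeff {s : ℕ} (w : Weights s) : Summable (korobovCoeff 1 w) := by
  have h1 : ∑' h : Fin s → ℤ, ENNReal.ofReal (korobovCoeff 1 w h) ≠ ∞ := by
    have : ∑' h : Fin s → ℤ, ENNReal.ofReal (korobovCoeff 1 w h)
        ≤ ∑' h : Fin s → ℤ, ((if h = 0 then 1 else 0)
          + (if h = 0 then 0 else ENNReal.ofReal (korobovCoeff 1 w h) ^ (1 : ℝ))) := by
      refine ENNReal.tsum_le_tsum fun h => ?_
      split_ifs with h0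
      · simp [korobovCoeff, h0]
      · simp
    refine ne_top_of_le_ne_top ?_ this
    rw [ENNReal.tsum_add, tsum_korobovCoeff_rpow w one_pos, tsum_ite_eq]
    refine ENNReal.add_ne_top.mpr ⟨ENNReal.one_ne_top, ?_⟩
    refine ENNReal.sum_ne_top.mpr fun u _ => ENNReal.mul_ne_top (by simp) ?_
    exact ENNReal.pow_ne_top (bilateralZeta_ne_top (by norm_num))
  have := ENNReal.summable_toReal h1
  simpa only [ENNReal.toReal_ofReal (korobovCoeff_nonneg _ _ _)] using this

/-! ### Characters and lattice points -/

/-- The point of the torus represented by a point of the cube. -/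
def toTorus {s : ℕ} (x : Cube s) : UnitAddTorus (Fin s) := fun j => ((x j : ℝ) : UnitAddCircle)

theorem continuous_toTorus {s : ℕ} : Continuous (toTorus : Cube s → UnitAddTorus (Fin s)) := by
  unfold toTorus
  exact continuous_pi fun j => (AddCircle.continuous_mk' 1).comp
    (continuous_subtype_val.comp (continuous_apply j))

/-- The points of a rank-1 lattice, in the cube. -/
def latticePoint {s : ℕ} (N : ℕ) (z : Fin s → ℕ) (n : ℕ) : Cube s :=
  fun j => fractI ((n : ℝ) * (z j : ℝ) / (N : ℝ))

theorem qmc_latticePoints {s : ℕ} (N : ℕ) (z : Fin s → ℕ) (f : Cube s → ℝ) :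
    qmc (latticePoints N z) f = (∑ n ∈ Finset.range N, f (latticePoint N z n)) / N := by
  simp only [qmc, latticePoints, Multiset.bind_def, Multiset.pure_def, Multiset.bind_singleton,
    Multiset.map_map, Multiset.card_map, Multiset.card_range]
  rfl

theorem qmc_tentLatticePoints {s : ℕ} (N : ℕ) (z : Fin s → ℕ) (f : Cube s → ℝ) :
    qmc (tentLatticePoints N z) f
      = (∑ n ∈ Finset.range N, f fun j => tent (latticePoint N z n j)) / N := by
  simp only [qmc, tentLatticePoints, latticePoints, Multiset.bind_def, Multiset.pure_def,
    Multiset.bind_singleton, Multiset.map_map, Multiset.card_map, Multiset.card_range]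
  rfl

/-- The circle ignores fractional parts, so along the lattice a character is the n-th power of one
root of unity and its sum is geometric. -/
theorem mFourier_latticePoint {s : ℕ} (N : ℕ) (z : Fin s → ℕ) (n : ℕ) (h : Fin s → ℤ) :
    UnitAddTorus.mFourier h (toTorus (latticePoint N z n))
      = Complex.exp (2 * Real.pi * Complex.I * ((∑ j, h j * (z j : ℤ) : ℤ) / (N : ℂ))) ^ n := by
  have : ∀ j, fourier (h j) (toTorus (latticePoint N z n) j)
      = Complex.exp (n * (2 * Real.pi * Complex.I * ((h j * (z j : ℤ) : ℤ) / (N : ℂ)))) := by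
    intro j
    have e : toTorus (latticePoint N z n) j
        = (((n : ℝ) * (z j : ℝ) / (N : ℝ) : ℝ) : UnitAddCircle) := by
      simp [toTorus, latticePoint, fractI]
    rw [e, fourier_coe_apply]
    congr 1
    push_cast
    ring
  simp only [UnitAddTorus.mFourier, ContinuousMap.coe_mk, this]
  rw [← Complex.exp_sum, ← Complex.exp_nat_mul]
  congr 1
  rw [← Finset.mul_sum, ← Finset.mul_sum, ← Finset.sum_div]
  push_cast
  ring

/-- The character property of rank-1 lattices. -/
theorem sum_mFourier_latticePoint {s : ℕ} {N : ℕ} (hN : N ≠ 0) (z : Fin s → ℕ)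
    (h : Fin s → ℤ) :
    (∑ n ∈ Finset.range N, UnitAddTorus.mFourier h (toTorus (latticePoint N z n))) / N
      = if (N : ℤ) ∣ ∑ j, h j * (z j : ℤ) then 1 else 0 := by
  have hN' : (N : ℂ) ≠ 0 := by exact_mod_cast hN
  simp only [mFourier_latticePoint]
  generalize (∑ j, h j * (z j : ℤ)) = m
  have hpi : (2 * Real.pi * Complex.I : ℂ) ≠ 0 := Complex.two_pi_I_ne_zero
  split_ifs with hd
  · obtain ⟨k, rfl⟩ := hd
    have : Complex.exp (2 * Real.pi * Complex.I * (((N * k : ℤ) : ℂ) / (N : ℂ))) = 1 := by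
      rw [Complex.exp_eq_one_iff]
      refine ⟨k, ?_⟩
      push_cast
      field_simp
    rw [this]
    simp [hN']
  · have h1 : Complex.exp (2 * Real.pi * Complex.I * ((m : ℂ) / (N : ℂ))) ≠ 1 := by
      intro hc
      obtain ⟨k, hk⟩ := Complex.exp_eq_one_iff.mp hc
      refine hd ⟨k, ?_⟩
      have : (m : ℂ) / N = k := by
        apply mul_left_cancel₀ hpi
        rw [hk]
        ring
      rw [div_eq_iff hN'] at this
      have h3 : ((m : ℤ) : ℂ) = ((N * k : ℤ) : ℂ) := by
        rw [this]
        push_cast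
        ring
      exact_mod_cast h3
    rw [geom_sum_eq h1, ← Complex.exp_nat_mul]
    have : Complex.exp ((N : ℂ) * (2 * Real.pi * Complex.I * ((m : ℂ) / (N : ℂ)))) = 1 := by
      rw [Complex.exp_eq_one_iff]
      refine ⟨m, ?_⟩
      field_simp
    simp [this]

/-! ### The worst-case error in the Korobov space -/

theorem integral_unitInterval_eq {E : Type*} [NormedAddCommGroup E] [NormedSpace ℝ E]
    (g : ℝ → E) : ∫ y : I, g y = ∫ y in (0 : ℝ)..1, g y := by
  rw [intervalIntegral.integral_of_le zero_le_one, ← integral_Icc_eq_integral_Ioc,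
    ← integral_subtype_comap measurableSet_Icc]
  rfl

theorem integral_mFourier_toTorus {s : ℕ} (h : Fin s → ℤ) :
    ∫ y : Cube s, UnitAddTorus.mFourier h (toTorus y) = if h = 0 then 1 else 0 := by
  have h1 : ∀ k : ℤ, ∫ y : I, fourier k ((y : ℝ) : UnitAddCircle) = if k = 0 then (1 : ℂ) else 0 := by
    intro k
    rw [integral_unitInterval_eq fun y : ℝ => fourier k (y : UnitAddCircle)]
    split_ifs with hk
    · simp [hk]
    · have hc : (2 * Real.pi * Complex.I * k : ℂ) ≠ 0 :=
        mul_ne_zero Complex.two_pi_I_ne_zero (by exact_mod_cast hk)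
      have e : ∀ y : ℝ, fourier k (y : UnitAddCircle)
          = Complex.exp (2 * Real.pi * Complex.I * k * y) := by
        intro y
        rw [fourier_coe_apply]
        simp
      simp only [e]
      rw [integral_exp_mul_complex hc]
      have : Complex.exp (2 * Real.pi * Complex.I * k * (1 : ℝ)) = 1 := by
        rw [Complex.exp_eq_one_iff]
        exact ⟨k, by push_cast; ring⟩
      rw [this]
      simp
  simp only [UnitAddTorus.mFourier, ContinuousMap.coe_mk, toTorus]
  rw [integral_fintype_prod_volume_eq_prod
    (fun j (y : I) => (fourier (h j) ((y : ℝ) : UnitAddCircle) : ℂ))]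
  simp only [h1]
  split_ifs with h0
  · simp [h0]
  · obtain ⟨j, hj⟩ := Function.ne_iff.mp h0
    exact Finset.prod_eq_zero (Finset.mem_univ j) (by simpa using hj)

theorem norm_mFourier_apply {s : ℕ} (h : Fin s → ℤ) (t : UnitAddTorus (Fin s)) :
    ‖UnitAddTorus.mFourier h t‖ = 1 := by
  simp only [UnitAddTorus.mFourier, fourier_apply, ContinuousMap.coe_mk, norm_prod,
    Circle.norm_coe, Finset.prod_const_one]

theorem HasFeatures.symm {X : Type} {k : X → X → ℝ} (hk : HasFeatures k) (x y : X) :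
    k x y = k y x := by
  obtain ⟨ι, f, hf⟩ := hk
  exact (hf x y).unique (by simpa [mul_comm] using hf y x)

/-- Separating x from y lets averages and integrals act on each variable on its own. -/
theorem korobovKernel_eq {s : ℕ} (α : ℝ) (w : Weights s) (x y : Cube s) :
    korobovKernel α w x y = (∑' h : Fin s → ℤ, (korobovCoeff α w h : ℂ) *
      (UnitAddTorus.mFourier h (toTorus x) * UnitAddTorus.mFourier (-h) (toTorus y))).re := by
  rw [korobovKernel]
  congr 1
  refine tsum_congr fun h => ?_
  congr 1
  simp only [UnitAddTorus.mFourier, ContinuousMap.coe_mk, toTorus, Pi.neg_apply, fourier_coe_apply]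
  rw [← Finset.prod_mul_distrib, Finset.mul_sum, Complex.exp_sum]
  refine Finset.prod_congr rfl fun j _ => ?_
  rw [← Complex.exp_add]
  congr 1
  push_cast
  ring

/-! ### The Korobov error as a sum over the dual lattice. -/

section
variable {s : ℕ} (w : Weights s)

theorem korobovTerm_norm_le (x y : Cube s) (h : Fin s → ℤ) :
    ‖(korobovCoeff 1 w h : ℂ) *
      (UnitAddTorus.mFourier h (toTorus x) * UnitAddTorus.mFourier (-h) (toTorus y))‖
      ≤ korobovCoeff 1 w h := by
  rw [norm_mul, norm_mul, norm_mFourier_apply, norm_mFourier_apply, mul_one, mul_one,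
    Complex.norm_real, Real.norm_of_nonneg (korobovCoeff_nonneg _ _ _)]

theorem summable_korobovTerm (x y : Cube s) :
    Summable fun h : Fin s → ℤ => (korobovCoeff 1 w h : ℂ) *
      (UnitAddTorus.mFourier h (toTorus x) * UnitAddTorus.mFourier (-h) (toTorus y)) :=
  (summable_korobovCoeff w).of_norm_bounded (korobovTerm_norm_le w x y)

theorem kernel_korobovSpace (x y : Cube s) :
    RKHS.kernel (KorobovSpace 1 w) x y (1 : ℝ) = korobovKernel 1 w x y := by
  rw [RKHS.OfKernel.kernel_ofKernel]
  simp [kernelMatrix]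

theorem continuous_korobovKernel :
    Continuous fun p : Cube s × Cube s =>
      RKHS.kernel (KorobovSpace 1 w) p.1 p.2 (1 : ℝ) := by
  simp only [kernel_korobovSpace, korobovKernel_eq]
  refine Complex.continuous_re.comp ?_
  refine continuous_tsum (fun h => ?_) (summable_korobovCoeff w)
    (fun h p => korobovTerm_norm_le w p.1 p.2 h)
  exact continuous_const.mul
    (((UnitAddTorus.mFourier h).continuous.comp (continuous_toTorus.comp continuous_fst)).mul
    ((UnitAddTorus.mFourier (-h)).continuous.comp (continuous_toTorus.comp continuous_snd)))

/-- Only the zero frequency survives integration, and its coefficient is 1. -/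
theorem integral_korobovKernel (x : Cube s) : ∫ y : Cube s, korobovKernel 1 w y x = 1 := by
  have hF : ∀ h : Fin s → ℤ, Continuous fun y : Cube s => (korobovCoeff 1 w h : ℂ) *
      (UnitAddTorus.mFourier h (toTorus y) * UnitAddTorus.mFourier (-h) (toTorus x)) := fun h =>
    continuous_const.mul (((UnitAddTorus.mFourier h).continuous.comp continuous_toTorus).mul
      continuous_const)
  have hsum := hasSum_integral_of_summable_integral_norm (μ := (volume : Measure (Cube s)))
    (F := fun (h : Fin s → ℤ) y => (korobovCoeff 1 w h : ℂ) *
      (UnitAddTorus.mFourier h (toTorus y) * UnitAddTorus.mFourier (-h) (toTorus x)))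
    (fun h => integrable_of_continuous _ (hF h)) (by
      have e : ∀ y h, ‖(korobovCoeff 1 w h : ℂ) *
          (UnitAddTorus.mFourier h (toTorus y) * UnitAddTorus.mFourier (-h) (toTorus x))‖
          = korobovCoeff 1 w h := by
        intro y h
        rw [norm_mul, norm_mul, norm_mFourier_apply, norm_mFourier_apply, mul_one, mul_one,
          Complex.norm_real, Real.norm_of_nonneg (korobovCoeff_nonneg _ _ _)]
      simp only [e]
      simpa using summable_korobovCoeff w)
  have e2 : ∀ h : Fin s → ℤ, ∫ y : Cube s, (korobovCoeff 1 w h : ℂ) *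
      (UnitAddTorus.mFourier h (toTorus y) * UnitAddTorus.mFourier (-h) (toTorus x))
      = if h = 0 then 1 else 0 := by
    intro h
    rw [integral_const_mul, integral_mul_const, integral_mFourier_toTorus]
    split_ifs with h0
    · simp [h0, korobovCoeff, UnitAddTorus.mFourier_zero]
    · simp
  simp only [e2] at hsum
  have h3 := hsum.unique (hasSum_ite_eq 0 1)
  simp only [korobovKernel_eq]
  have hint : Integrable fun y : Cube s => ∑' h : Fin s → ℤ, (korobovCoeff 1 w h : ℂ) *
      (UnitAddTorus.mFourier h (toTorus y) * UnitAddTorus.mFourier (-h) (toTorus x)) :=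
    integrable_of_continuous _ (continuous_tsum hF (summable_korobovCoeff w)
      (fun h y => korobovTerm_norm_le w y x h))
  have h4 := integral_re hint
  simp only [RCLike.re_eq_complex_re] at h4
  rw [h4, h3, Complex.one_re]

/-- The sum of the Korobov coefficients over the nonzero vectors of the dual lattice. -/
def dualSum (N : ℕ) (z : Fin s → ℕ) : ℝ≥0∞ :=
  ∑' h : Fin s → ℤ, if h ≠ 0 ∧ (N : ℤ) ∣ ∑ j, h j * (z j : ℤ)
    then ENNReal.ofReal (korobovCoeff 1 w h) else 0

/-- Averaging both variables over the lattice multiplies each coefficient by the character means at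
h and at -h, which are the same 0-1 indicator. -/
theorem sum_sum_korobovKernel {N : ℕ} (hN : N ≠ 0) (z : Fin s → ℕ) :
    HasSum (fun h : Fin s → ℤ => if (N : ℤ) ∣ ∑ j, h j * (z j : ℤ) then korobovCoeff 1 w h else 0)
      ((∑ n ∈ Finset.range N, (∑ m ∈ Finset.range N,
        korobovKernel 1 w (latticePoint N z n) (latticePoint N z m)) / N) / N) := by
  have hs : HasSum (fun h : Fin s → ℤ => (∑ n ∈ Finset.range N, (∑ m ∈ Finset.range N,
      (korobovCoeff 1 w h : ℂ) * (UnitAddTorus.mFourier h (toTorus (latticePoint N z n)) *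
        UnitAddTorus.mFourier (-h) (toTorus (latticePoint N z m)))) / N) / N)
      ((∑ n ∈ Finset.range N, (∑ m ∈ Finset.range N, ∑' h : Fin s → ℤ,
      (korobovCoeff 1 w h : ℂ) * (UnitAddTorus.mFourier h (toTorus (latticePoint N z n)) *
        UnitAddTorus.mFourier (-h) (toTorus (latticePoint N z m)))) / N) / N) :=
    (hasSum_sum fun n _ => (hasSum_sum fun m _ =>
      (summable_korobovTerm w _ _).hasSum).div_const _).div_const _
  have h2 := Complex.hasSum_re hs
  convert h2 using 1
  · funext h
    have e : (∑ n ∈ Finset.range N, (∑ m ∈ Finset.range N,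
      (korobovCoeff 1 w h : ℂ) * (UnitAddTorus.mFourier h (toTorus (latticePoint N z n)) *
        UnitAddTorus.mFourier (-h) (toTorus (latticePoint N z m)))) / N) / N
        = korobovCoeff 1 w h *
          ((∑ n ∈ Finset.range N, UnitAddTorus.mFourier h (toTorus (latticePoint N z n))) / N) *
          ((∑ n ∈ Finset.range N, UnitAddTorus.mFourier (-h) (toTorus (latticePoint N z n))) / N) := by
      simp only [← Finset.mul_sum, mul_div_assoc, ← Finset.sum_mul]
      ring
    rw [e, sum_mFourier_latticePoint hN, sum_mFourier_latticePoint hN]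
    have : (N : ℤ) ∣ ∑ j, (-h) j * (z j : ℤ) ↔ (N : ℤ) ∣ ∑ j, h j * (z j : ℤ) := by
      simp
    simp only [this]
    split_ifs <;> simp
  · simp only [korobovKernel_eq]
    simp [Complex.div_natCast_re]

/-- The error representer ξ is the mean of the kernel sections at the lattice points minus the
constant 1. Its squared norm is the error functional applied to ξ itself; the integral of ξ is 0, so
only its lattice mean remains, and subtracting 1 removes the term h = 0. -/
theorem worstCaseError_korobovSpace_sq {N : ℕ} (hN : N ≠ 0) (z : Fin s → ℕ) :
    worstCaseError (KorobovSpace 1 w) (latticePoints N z) ^ 2 = dualSum w N z := by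
  have hk := continuous_korobovKernel w
  have hN' : (N : ℝ) ≠ 0 := by exact_mod_cast hN
  set ξ : KorobovSpace 1 w :=
    (N : ℝ)⁻¹ • ∑ n ∈ Finset.range N, evalRep (KorobovSpace 1 w) (latticePoint N z n)
      - integralRep (volume : Measure (Cube s)) (KorobovSpace 1 w) id fun _ => 1 with hξdef
  have hξ : ∀ f : KorobovSpace 1 w,
      qmc (latticePoints N z) f - ∫ x : Cube s, f x = inner ℝ f ξ := by
    intro f
    rw [hξdef, inner_sub_right, inner_integralRep _ hk continuous_id continuous_const,
      real_inner_smul_right, inner_sum, qmc_latticePoints]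
    simp only [inner_evalRep, id, one_mul]
    rw [inv_mul_eq_div]
  have hval : ∀ x, ξ x = (∑ n ∈ Finset.range N, korobovKernel 1 w x (latticePoint N z n)) / N
      - 1 := by
    intro x
    rw [← inner_evalRep, real_inner_comm, hξdef, inner_sub_right,
      inner_integralRep _ hk continuous_id continuous_const, real_inner_smul_right, inner_sum]
    simp only [inner_evalRep, evalRep_apply, kernel_korobovSpace, id, one_mul]
    rw [integral_korobovKernel, inv_mul_eq_div]
    congr 2
    refine Finset.sum_congr rfl fun n _ => ?_
    exact (korobovKernel_hasFeatures 1 w).symm _ _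
  rw [worstCaseError_eq_norm hξ, ← ENNReal.ofReal_pow (norm_nonneg _),
    ← real_inner_self_eq_norm_sq, ← hξ]
  have hcont : ∀ n, Continuous fun x => korobovKernel 1 w x (latticePoint N z n) := by
    intro n
    have := hk.comp (Continuous.prodMk_left (latticePoint N z n))
    simpa only [Function.comp_def, kernel_korobovSpace] using this
  have hint : ∫ x : Cube s, ξ x = 0 := by
    simp only [hval]
    rw [integral_sub ((integrable_finsetSum _ fun n _ =>
      integrable_of_continuous _ (hcont n)).div_const _) (integrable_const _),
      integral_div, integral_finsetSum _ fun n _ => integrable_of_continuous _ (hcont n)]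
    simp [integral_korobovKernel, hN']
  rw [hint, sub_zero, qmc_latticePoints]
  have hS := sum_sum_korobovKernel w hN z
  have hS' := hS.sub (hasSum_ite_eq (0 : Fin s → ℤ) (1 : ℝ))
  have e : (∑ n ∈ Finset.range N, ξ (latticePoint N z n)) / N
      = ((∑ n ∈ Finset.range N, (∑ m ∈ Finset.range N,
        korobovKernel 1 w (latticePoint N z n) (latticePoint N z m)) / N) / N) - 1 := by
    simp only [hval, Finset.sum_sub_distrib]
    simp [sub_div, hN']
  rw [e, ← hS'.tsum_eq, dualSum]
  have e2 : ∀ h : Fin s → ℤ, (if (N : ℤ) ∣ ∑ j, h j * (z j : ℤ) then korobovCoeff 1 w h else 0)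
      - (if h = 0 then 1 else 0) = if h ≠ 0 ∧ (N : ℤ) ∣ ∑ j, h j * (z j : ℤ)
        then korobovCoeff 1 w h else 0 := by
    intro h
    rcases eq_or_ne h 0 with rfl | h0
    · simp [korobovCoeff]
    · simp [h0]
  have hS2 := hS'.summable
  simp only [e2] at hS2 ⊢
  rw [ENNReal.ofReal_tsum_of_nonneg (fun h => ?_) hS2]
  · refine tsum_congr fun h => ?_
    split_ifs <;> simp
  · split_ifs
    · exact korobovCoeff_nonneg _ _ _
    · exact le_rfl

end

/-! ### The component-by-component algorithm -/

/-- Jensen's inequality. Moving the exponent to the right reduces it to finite sums, where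
subadditivity of x ↦ x^l is iterated. -/
theorem tsum_rpow_le_tsum_rpow {ι : Type*} (a : ι → ℝ≥0∞) {l : ℝ} (hl : 0 < l) (hl1 : l ≤ 1) :
    (∑' i, a i) ^ l ≤ ∑' i, a i ^ l := by
  rw [← ENNReal.le_rpow_inv_iff hl, ENNReal.tsum_eq_iSup_sum]
  refine iSup_le fun S => ?_
  rw [ENNReal.le_rpow_inv_iff hl]
  refine le_trans ?_ (ENNReal.sum_le_tsum S)
  classical
  induction S using Finset.induction_on with
  | empty => simp [hl]
  | insert i S hi ih =>
    rw [Finset.sum_insert hi, Finset.sum_insert hi]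
    exact (ENNReal.rpow_add_le_add_rpow _ _ hl.le hl1).trans (by gcongr)

/-! ### Splitting the dual lattice by the last nonzero index. -/

section
variable {s : ℕ} (w : Weights s)

/-- `i` is the last index of a nonzero component of `h`. -/
def IsLast (i : Fin s) (h : Fin s → ℤ) : Prop := h i ≠ 0 ∧ ∀ j, i < j → h j = 0

-- A nonzero vector has exactly one last nonzero index; the zero vector has none.
open scoped Classical in
theorem sum_isLast (h : Fin s → ℤ) (a : ℝ≥0∞) :
    ∑ i, (if IsLast i h then a else 0) = if h ≠ 0 then a else 0 := by
  split_ifs with h0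
  · have hne : (Finset.univ.filter fun j => h j ≠ 0).Nonempty := by
      obtain ⟨j, hj⟩ := Function.ne_iff.mp h0
      exact ⟨j, by simpa using hj⟩
    set m := (Finset.univ.filter fun j => h j ≠ 0).max' hne with hm
    have hmL : IsLast m h := by
      refine ⟨by simpa using Finset.max'_mem _ hne, fun j hj => ?_⟩
      by_contra hc
      exact absurd (Finset.le_max' (Finset.univ.filter fun j => h j ≠ 0) j (by simpa using hc))
        (not_le.mpr hj)
    rw [Finset.sum_eq_single_of_mem m (Finset.mem_univ _), if_pos hmL]
    intro i _ hi
    rw [if_neg]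
    intro hiL
    rcases lt_or_gt_of_ne hi with hlt | hlt
    · exact hmL.1 (hiL.2 m hlt)
    · exact hiL.1 (hmL.2 i hlt)
  · push Not at h0
    refine Finset.sum_eq_zero fun i _ => ?_
    rw [if_neg]
    exact fun hL => hL.1 (by simp [h0])

open scoped Classical in
/-- The part of the dual lattice sum over the vectors with last nonzero index `i`. -/
def lastSum (l : ℝ) (N : ℕ) (z : Fin s → ℕ) (i : Fin s) : ℝ≥0∞ :=
  ∑' h : Fin s → ℤ, if IsLast i h ∧ (N : ℤ) ∣ ∑ j, h j * (z j : ℤ)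
    then ENNReal.ofReal (korobovCoeff 1 w h) ^ l else 0

open scoped Classical in
/-- The part of the dual lattice sum over the vectors supported in the first `d` coordinates. -/
def initialSum (N : ℕ) (z : Fin s → ℕ) (d : ℕ) : ℝ≥0∞ :=
  ∑' h : Fin s → ℤ, if (h ≠ 0 ∧ ∀ j : Fin s, d ≤ j → h j = 0) ∧
    (N : ℤ) ∣ ∑ j, h j * (z j : ℤ) then ENNReal.ofReal (korobovCoeff 1 w h) else 0

/-- The part already fixed does not see later components, since these are multiplied by zeros of h.
-/
theorem initialSum_congr {N : ℕ} {z z' : Fin s → ℕ} {d : ℕ}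
    (hz : ∀ j : Fin s, (j : ℕ) < d → z j = z' j) : initialSum w N z d = initialSum w N z' d := by
  refine tsum_congr fun h => ?_
  refine if_congr (and_congr_right fun hh => ?_) rfl rfl
  have : ∑ j, h j * (z j : ℤ) = ∑ j, h j * (z' j : ℤ) := by
    refine Finset.sum_congr rfl fun j _ => ?_
    rcases lt_or_ge (j : ℕ) d with hj | hj
    · rw [hz j hj]
    · rw [hh.2 j hj, zero_mul, zero_mul]
  rw [this]

/-- A vector supported in the first d + 1 coordinates either vanishes at index d (counted from 0) or
has d as its last nonzero index. -/
theorem initialSum_succ (N : ℕ) (z : Fin s → ℕ) {d : ℕ} (hd : d < s) :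
    initialSum w N z (d + 1) = initialSum w N z d + lastSum w 1 N z ⟨d, hd⟩ := by
  classical
  rw [initialSum, initialSum, lastSum, ← ENNReal.tsum_add]
  refine tsum_congr fun h => ?_
  by_cases hdv : (N : ℤ) ∣ ∑ j, h j * (z j : ℤ)
  swap
  · simp [hdv]
  simp only [hdv, and_true, ENNReal.rpow_one]
  by_cases h0 : h ⟨d, hd⟩ = 0
  · have h1 : ¬ IsLast ⟨d, hd⟩ h := fun hL => hL.1 h0
    rw [if_neg h1, add_zero]
    refine if_congr (and_congr_right fun _ => ⟨fun H j hj => ?_, fun H j hj => H j (by omega)⟩)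
      rfl rfl
    rcases hj.eq_or_lt with e | e
    · rw [show j = ⟨d, hd⟩ from Fin.ext e.symm, h0]
    · exact H j e
  · have h1 : ¬ (h ≠ 0 ∧ ∀ j : Fin s, d ≤ j → h j = 0) := fun H => h0 (H.2 ⟨d, hd⟩ le_rfl)
    rw [if_neg h1, zero_add]
    refine if_congr ⟨fun H => ⟨h0, fun j hj => H.2 j hj⟩, fun H => ⟨?_, fun j hj => H.2 j hj⟩⟩
      rfl rfl
    rintro rfl
    exact h0 rfl

theorem initialSum_le_dualSum (N : ℕ) (z : Fin s → ℕ) (d : ℕ) :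
    initialSum w N z d ≤ dualSum w N z := by
  refine ENNReal.tsum_le_tsum fun h => ?_
  split_ifs with h1 h2 h2
  · exact le_rfl
  · exact absurd ⟨h1.1.1, h1.2⟩ h2
  · exact zero_le
  · exact le_rfl

/-- Finiteness is what later allows a common summand to be cancelled in `ℝ≥0∞`. -/
theorem dualSum_ne_top (N : ℕ) (z : Fin s → ℕ) : dualSum w N z ≠ ∞ := by
  refine ne_top_of_le_ne_top (summable_korobovCoeff w).tsum_ofReal_ne_top ?_
  refine ENNReal.tsum_le_tsum fun h => ?_
  split_ifs <;> simp

theorem dualSum_eq_sum_lastSum (N : ℕ) (z : Fin s → ℕ) :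
    dualSum w N z = ∑ i, lastSum w 1 N z i := by
  classical
  simp only [lastSum, dualSum]
  rw [← Summable.tsum_finsetSum fun _ _ => ENNReal.summable]
  refine tsum_congr fun h => ?_
  by_cases hdv : (N : ℤ) ∣ ∑ j, h j * (z j : ℤ)
  · simp only [hdv, and_true, ENNReal.rpow_one, sum_isLast]
  · simp [hdv]

/-- Extension of a vector by zeros. -/
def extendZero {d : ℕ} (s : ℕ) (h : Fin d → ℤ) : Fin s → ℤ :=
  fun j => if hj : (j : ℕ) < d then h ⟨j, hj⟩ else 0

theorem extendZero_castLE {d : ℕ} (hd : d ≤ s) (h : Fin d → ℤ) (j : Fin d) :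
    extendZero s h (Fin.castLE hd j) = h j := by
  simp [extendZero]

theorem sum_extendZero {M : Type*} [AddCommMonoid M] {d : ℕ} (hd : d ≤ s) (h : Fin d → ℤ)
    (F : Fin s → ℤ → M) (hF : ∀ j, F j 0 = 0) :
    ∑ j, F j (extendZero s h j) = ∑ j, F (Fin.castLE hd j) (h j) := by
  rw [← Finset.sum_subset (Finset.subset_univ (Finset.univ.map (Fin.castLEEmb hd)))]
  · simp [extendZero_castLE]
  · intro j _ hj
    have : ¬ (j : ℕ) < d := by
      intro hlt
      exact hj (Finset.mem_map.mpr ⟨⟨j, hlt⟩, Finset.mem_univ _, Fin.ext rfl⟩)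
    simp [extendZero, this, hF]

theorem korobovCoeff_extendZero {d : ℕ} (hd : d ≤ s) (h : Fin d → ℤ) (α : ℝ) :
    korobovCoeff α w (extendZero s h) = korobovCoeff α (restrictWeights hd w) h := by
  have h0 : extendZero s h = 0 ↔ h = 0 := by
    constructor
    · intro H
      funext j
      have := congrFun H (Fin.castLE hd j)
      rwa [extendZero_castLE] at this
    · rintro rfl
      funext j
      simp [extendZero]
  have hf : (Finset.univ.filter fun j => extendZero s h j ≠ 0)
      = (Finset.univ.filter fun j => h j ≠ 0).map (Fin.castLEEmb hd) := by
    ext j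
    simp only [Finset.mem_filter, Finset.mem_univ, true_and, Finset.mem_map]
    constructor
    · intro hj
      have hlt : (j : ℕ) < d := by
        by_contra hc
        exact hj (by simp [extendZero, hc])
      refine ⟨⟨j, hlt⟩, ?_, Fin.ext rfl⟩
      simpa [extendZero, hlt] using hj
    · rintro ⟨k, hk, rfl⟩
      rw [Fin.castLEEmb_apply, extendZero_castLE]
      exact hk
  unfold korobovCoeff
  rw [hf]
  simp only [h0, Finset.prod_map, Fin.castLEEmb_apply, extendZero_castLE, restrictWeights]

/-- Extension by zeros identifies the d-dimensional vectors with those supported in the first d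
coordinates, preserving coefficients and scalar products. The criteria of all dimensions thus live
in dimension s. -/
theorem dualSum_restrictWeights {d : ℕ} (hd : d ≤ s) (N : ℕ) (z : Fin s → ℕ) :
    dualSum (restrictWeights hd w) N (fun j => z (Fin.castLE hd j)) = initialSum w N z d := by
  classical
  have hinj : Function.Injective (extendZero s : (Fin d → ℤ) → Fin s → ℤ) := by
    intro h h' H
    funext j
    rw [← extendZero_castLE hd h, H, extendZero_castLE]
  rw [initialSum, ← hinj.tsum_eq]
  · refine tsum_congr fun h => ?_
    rw [korobovCoeff_extendZero w hd,
      sum_extendZero hd h (fun j k => k * (z j : ℤ)) (fun j => zero_mul _)]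
    refine if_congr (and_congr_left fun _ => ⟨fun H => ⟨fun H' => H ?_, fun j hj => ?_⟩,
      fun H H' => H.1 ?_⟩) rfl rfl
    · refine hinj (H'.trans ?_)
      funext j
      simp [extendZero]
    · simp [extendZero, not_lt.mpr hj]
    · rw [H']
      funext j
      simp [extendZero]
  · intro h hh
    simp only [Function.mem_support, ne_eq, ite_eq_right_iff, Classical.not_imp] at hh
    refine ⟨fun j => h (Fin.castLE hd j), ?_⟩
    funext j
    by_cases hj : (j : ℕ) < d
    · simp [extendZero, hj, Fin.castLE]
    · simp [extendZero, hj, hh.1.1.2 j (not_lt.mp hj)]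

/-! ### Averaging over the candidates for one component. -/

theorem korobovCoeff_update_mul {N : ℕ} (hN : N ≠ 0) {h : Fin s → ℤ} {i : Fin s} (hi : h i ≠ 0) :
    korobovCoeff 1 w (Function.update h i (N * h i)) = (N : ℝ) ^ (-2 : ℝ) * korobovCoeff 1 w h := by
  have hNi : (N : ℤ) * h i ≠ 0 := mul_ne_zero (by exact_mod_cast hN) hi
  have h1 : h ≠ 0 := fun H => hi (by simp [H])
  have h2 : Function.update h i (N * h i) ≠ 0 := fun H => hNi (by
    have := congrFun H i
    simpa using this)
  have hf : (Finset.univ.filter fun j => Function.update h i (N * h i) j ≠ 0)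
      = Finset.univ.filter fun j => h j ≠ 0 := by
    ext j
    simp only [Finset.mem_filter, Finset.mem_univ, true_and]
    rcases eq_or_ne j i with rfl | hj
    · simp only [Function.update_self]
      tauto
    · rw [Function.update_of_ne hj]
  have hmem : i ∈ Finset.univ.filter fun j => h j ≠ 0 := by simpa using hi
  rw [korobovCoeff, if_neg h2, korobovCoeff, if_neg h1, hf, ← Finset.mul_prod_erase _ _ hmem,
    ← Finset.mul_prod_erase _ _ hmem]
  have e : ∏ x ∈ (Finset.univ.filter fun j => h j ≠ 0).erase i,
      |((Function.update h i (N * h i) x : ℤ) : ℝ)| ^ (-2 * (1 : ℝ))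
      = ∏ x ∈ (Finset.univ.filter fun j => h j ≠ 0).erase i, |(h x : ℝ)| ^ (-2 * (1 : ℝ)) := by
    refine Finset.prod_congr rfl fun x hx => ?_
    rw [Function.update_of_ne (Finset.ne_of_mem_erase hx)]
  rw [e, Function.update_self]
  push_cast
  rw [abs_mul, Nat.abs_cast, Real.mul_rpow (by positivity) (by positivity), mul_one]
  ring

theorem sum_mul_update (h : Fin s → ℤ) (z : Fin s → ℕ) (i : Fin s) (c : ℕ) :
    ∑ j, h j * (Function.update z i c j : ℤ)
      = ∑ j, h j * (Function.update z i 0 j : ℤ) + h i * c := by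
  rw [← Finset.add_sum_erase _ _ (Finset.mem_univ i),
    ← Finset.add_sum_erase _ (fun j => h j * (Function.update z i 0 j : ℤ)) (Finset.mem_univ i)]
  have : ∀ c', ∑ x ∈ Finset.univ.erase i, h x * (Function.update z i c' x : ℤ)
      = ∑ x ∈ Finset.univ.erase i, h x * (z x : ℤ) := by
    intro c'
    refine Finset.sum_congr rfl fun x hx => ?_
    rw [Function.update_of_ne (Finset.ne_of_mem_erase hx)]
  rw [this, this]
  simp
  ring

/-- For a prime `N`, the congruence `A + k c ≡ 0` has few solutions `c ∈ {1, …, N - 1}`. -/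
theorem card_filter_dvd_le {N : ℕ} (hN : N.Prime) (A k : ℤ) :
    ((Finset.Icc 1 (N - 1)).filter fun c : ℕ => (N : ℤ) ∣ A + k * c).card
      ≤ (if (N : ℤ) ∣ A then 0 else 1)
        + (if (N : ℤ) ∣ k ∧ (N : ℤ) ∣ A then N - 1 else 0) := by
  have hp : Prime (N : ℤ) := Nat.prime_iff_prime_int.mp hN
  by_cases hk : (N : ℤ) ∣ k
  · by_cases hA : (N : ℤ) ∣ A
    · simp only [hA, hk, and_self, if_true, zero_add]
      refine (Finset.card_filter_le _ _).trans (by simp)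
    · rw [Finset.filter_false_of_mem]
      · simp
      · intro c _ hc
        exact hA ((dvd_add_left (hk.mul_right _)).mp hc)
  · simp only [hk, false_and, if_false, add_zero]
    -- If N ∣ A but N ∤ k there is no solution, because c is a nonzero residue. This zero leaves
    -- room for the multiples of N in `sum_lastSum_update_le`.
    split_ifs with hA
    · rw [Finset.filter_false_of_mem]
      · simp
      · intro c hc hd
        rw [Finset.mem_Icc] at hc
        rcases hp.dvd_or_dvd ((dvd_add_right hA).mp hd) with h | h
        · exact hk h
        · have := Nat.le_of_dvd (by omega) (Int.natCast_dvd_natCast.mp h)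
          omega
    · refine Finset.card_le_one.mpr fun c hc c' hc' => ?_
      simp only [Finset.mem_filter, Finset.mem_Icc] at hc hc'
      have h1 : (N : ℤ) ∣ k * ((c : ℤ) - c') := by
        have := dvd_sub hc.2 hc'.2
        rwa [show A + k * (c : ℤ) - (A + k * c') = k * ((c : ℤ) - c') by ring] at this
      rcases hp.dvd_or_dvd h1 with h | h
      · exact absurd h hk
      · have := Int.eq_zero_of_abs_lt_dvd h (by rw [abs_lt]; omega)
        omega

/-- With modulus 1 the divisibility condition is void, so the right side runs over all h with last
index i. Let A(h) be h·z without the i-th term. If N ∤ A(h), at most one c makes h dual. If N ∣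
A(h), none does unless N ∣ h_i, and then all N - 1 do; but dividing h_i by N shows that these
vectors carry only N^(-2l) times the mass of the whole class N ∣ A(h). -/
theorem sum_lastSum_update_le {N : ℕ} (hN : N.Prime) (z : Fin s → ℕ) (i : Fin s) {l : ℝ}
    (hl : 1 / 2 < l) :
    ∑ c ∈ Finset.Icc 1 (N - 1), lastSum w l N (Function.update z i c) i
      ≤ lastSum w l 1 z i := by
  classical
  have hl0 : 0 < l := by linarith
  set A : (Fin s → ℤ) → ℤ := fun h => ∑ j, h j * (Function.update z i 0 j : ℤ) with hA
  set R : (Fin s → ℤ) → ℝ≥0∞ := fun h => ENNReal.ofReal (korobovCoeff 1 w h) ^ l with hR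
  have hscale : ∑' h, (if IsLast i h ∧ (N : ℤ) ∣ h i ∧ (N : ℤ) ∣ A h then R h else 0)
      = ∑' h, ENNReal.ofReal ((N : ℝ) ^ (-2 * l)) * (if IsLast i h ∧ (N : ℤ) ∣ A h then R h else 0)
      := by
    have hN0 : (N : ℤ) ≠ 0 := by exact_mod_cast hN.ne_zero
    have hinj : Function.Injective fun h : Fin s → ℤ => Function.update h i (N * h i) := by
      intro h h' H
      funext j
      have := congrFun H j
      rcases eq_or_ne j i with rfl | hj
      · simpa [hN.ne_zero] using this
      · simpa [hj] using this
    -- Substitution h_i ↦ N h_i: it leaves A and the last index unchanged, and its range contains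
    -- every h with N ∣ h_i.
    rw [← hinj.tsum_eq]
    · refine tsum_congr fun h => ?_
      have e1 : A (Function.update h i (N * h i)) = A h := by
        refine Finset.sum_congr rfl fun j _ => ?_
        rcases eq_or_ne j i with rfl | hj
        · simp
        · simp [hj]
      have e2 : IsLast i (Function.update h i (N * h i)) ↔ IsLast i h := by
        refine and_congr (by simp [hN.ne_zero]) (forall_congr' fun j => forall_congr' fun hj => ?_)
        rw [Function.update_of_ne hj.ne']
      simp only [e1, e2, Function.update_self, dvd_mul_right, true_and]
      split_ifs with hc
      · simp only [hR]
        rw [korobovCoeff_update_mul w hN.ne_zero hc.1.1, ENNReal.ofReal_mul (by positivity),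
          ENNReal.mul_rpow_of_nonneg _ _ hl0.le, ENNReal.ofReal_rpow_of_nonneg (by positivity)
          hl0.le, ← Real.rpow_mul (by positivity)]
      · simp
    · intro h hh
      simp only [Function.mem_support, ne_eq, ite_eq_right_iff, Classical.not_imp] at hh
      obtain ⟨k, hk⟩ := hh.1.2.1
      refine ⟨Function.update h i k, ?_⟩
      simp [← hk]
  -- Here l > 1/2 enters, through N^(-2l) ≤ N^(-1).
  have hbound : ((N - 1 : ℕ) : ℝ≥0∞) * ENNReal.ofReal ((N : ℝ) ^ (-2 * l)) ≤ 1 := by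
    rw [← ENNReal.ofReal_natCast, ← ENNReal.ofReal_mul (by positivity), ENNReal.ofReal_le_one]
    have hN1 : (1 : ℝ) ≤ N := by exact_mod_cast hN.one_lt.le
    calc ((N - 1 : ℕ) : ℝ) * (N : ℝ) ^ (-2 * l) ≤ (N : ℝ) ^ (1 : ℝ) * (N : ℝ) ^ (-1 : ℝ) := by
          rw [Real.rpow_one]
          gcongr
          · omega
          · linarith
      _ = 1 := by
          rw [← Real.rpow_add (by linarith)]
          simp
  have hcount : ∀ h, ∑ c ∈ Finset.Icc 1 (N - 1),
      (if IsLast i h ∧ (N : ℤ) ∣ ∑ j, h j * (Function.update z i c j : ℤ) then R h else 0)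
      ≤ (if IsLast i h ∧ ¬ (N : ℤ) ∣ A h then R h else 0) + ((N - 1 : ℕ) : ℝ≥0∞) *
        (if IsLast i h ∧ (N : ℤ) ∣ h i ∧ (N : ℤ) ∣ A h then R h else 0) := by
    intro h
    by_cases hL : IsLast i h
    swap
    · simp [hL]
    simp only [hL, true_and]
    rw [← Finset.sum_filter, Finset.sum_const, nsmul_eq_mul]
    have := card_filter_dvd_le hN (A h) (h i)
    have hf : ((Finset.Icc 1 (N - 1)).filter fun c : ℕ =>
        (N : ℤ) ∣ ∑ j, h j * (Function.update z i c j : ℤ))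
        = (Finset.Icc 1 (N - 1)).filter fun c : ℕ => (N : ℤ) ∣ A h + h i * c :=
      Finset.filter_congr fun c _ => by rw [sum_mul_update]
    rw [hf]
    have h2 : (((Finset.Icc 1 (N - 1)).filter fun c : ℕ => (N : ℤ) ∣ A h + h i * c).card : ℝ≥0∞)
        ≤ (((if (N : ℤ) ∣ A h then 0 else 1)
        + (if (N : ℤ) ∣ h i ∧ (N : ℤ) ∣ A h then N - 1 else 0) : ℕ) : ℝ≥0∞) := by
      exact_mod_cast this
    refine (mul_le_mul_left h2 _).trans (le_of_eq ?_)
    push_cast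
    rw [add_mul]
    congr 1
    · split_ifs <;> simp
    · split_ifs <;> simp
  simp only [lastSum]
  rw [← Summable.tsum_finsetSum fun _ _ => ENNReal.summable]
  refine (ENNReal.tsum_le_tsum hcount).trans ?_
  rw [ENNReal.tsum_add, ENNReal.tsum_mul_left, hscale, ENNReal.tsum_mul_left, ← mul_assoc]
  refine (add_le_add_right (mul_le_of_le_one_left zero_le hbound) _).trans ?_
  rw [← ENNReal.tsum_add]
  refine ENNReal.tsum_le_tsum fun h => ?_
  by_cases hL : IsLast i h <;> by_cases hd : (N : ℤ) ∣ A h <;> simp [hL, hd, hR]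

/-- Modulus 1 makes every vector dual, so the last-index classes together exhaust the nonzero
vectors. -/
theorem sum_lastSum_one {l : ℝ} (z : Fin s → ℕ) :
    ∑ i, lastSum w l 1 z i
      = ∑' h : Fin s → ℤ, (if h = 0 then 0 else ENNReal.ofReal (korobovCoeff 1 w h) ^ l) := by
  classical
  simp only [lastSum, Nat.cast_one, isUnit_one, IsUnit.dvd, and_true]
  rw [← Summable.tsum_finsetSum fun _ _ => ENNReal.summable]
  refine tsum_congr fun h => ?_
  rw [sum_isLast, ite_not]

/-- If every component is at least as good as the average, the dual lattice sum is small. -/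
theorem mul_dualSum_rpow_le {N : ℕ} (hN : N.Prime) (z : Fin s → ℕ)
    (hz : ∀ i, ∀ c ∈ Finset.Icc 1 (N - 1),
      lastSum w 1 N z i ≤ lastSum w 1 N (Function.update z i c) i)
    {l : ℝ} (hl : 1 / 2 < l) (hl1 : l ≤ 1) :
    ((N - 1 : ℕ) : ℝ≥0∞) * dualSum w N z ^ l
      ≤ ∑ u : Finset (Fin s) with u.Nonempty, (w u : ℝ≥0∞) ^ l * bilateralZeta l ^ u.card := by
  classical
  have hl0 : 0 < l := by linarith
  rw [← tsum_korobovCoeff_rpow w hl0, ← sum_lastSum_one w z, dualSum_eq_sum_lastSum]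
  have h1 : (∑ i, lastSum w 1 N z i) ^ l ≤ ∑ i, lastSum w 1 N z i ^ l := by
    have := tsum_rpow_le_tsum_rpow (fun i => lastSum w 1 N z i) hl0 hl1
    simpa only [tsum_fintype] using this
  refine (mul_le_mul_right h1 _).trans ?_
  rw [Finset.mul_sum]
  refine Finset.sum_le_sum fun i _ => ?_
  -- The left side is one copy per candidate c. Each copy is bounded by the value at c, and Jensen's
  -- inequality then moves the exponent inside the sum over h.
  calc ((N - 1 : ℕ) : ℝ≥0∞) * lastSum w 1 N z i ^ l
      = ∑ c ∈ Finset.Icc 1 (N - 1), lastSum w 1 N z i ^ l := by simp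
    _ ≤ ∑ c ∈ Finset.Icc 1 (N - 1), lastSum w l N (Function.update z i c) i := by
        refine Finset.sum_le_sum fun c hc => ?_
        refine (ENNReal.rpow_le_rpow (hz i c hc) hl0.le).trans ?_
        refine (tsum_rpow_le_tsum_rpow _ hl0 hl1).trans (ENNReal.tsum_le_tsum fun h => ?_)
        split_ifs <;> simp [hl0]
    _ ≤ lastSum w l 1 z i := sum_lastSum_update_le w hN z i hl

end

/-! ### From the algorithm to the minimality of each `lastSum`. -/

theorem snoc_castLE_eq {s d : ℕ} (hd : d < s) (z : Fin s → ℕ) (c : ℕ) :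
    (Fin.snoc (fun j => z (Fin.castLE hd.le j)) c : Fin (d + 1) → ℕ)
      = fun j => Function.update z ⟨d, hd⟩ c (Fin.castLE hd j) := by
  funext j
  refine Fin.lastCases ?_ (fun j => ?_) j
  · have : Fin.castLE hd (Fin.last d) = ⟨d, hd⟩ := rfl
    simp [this]
  · have : Fin.castLE hd j.castSucc ≠ ⟨d, hd⟩ := fun H => by
      have := congrArg Fin.val H
      simp at this
      omega
    rw [Fin.snoc_castSucc, Function.update_of_ne this]
    rfl

/-- The candidate c enters only the second summand. The first is fixed by the earlier components
and, being finite, cancels when two candidates are compared. -/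
theorem korobovCriterion_snoc {s d N : ℕ} (hN : N ≠ 0) (γ : Weights s) (hd : d < s)
    (z : Fin s → ℕ) (c : ℕ) :
    korobovCriterion γ N (d + 1) hd (Fin.snoc (fun j => z (Fin.castLE hd.le j)) c)
      = initialSum (sqrtModifiedWeights γ) N z d
        + lastSum (sqrtModifiedWeights γ) 1 N (Function.update z ⟨d, hd⟩ c) ⟨d, hd⟩ := by
  rw [korobovCriterion, worstCaseError_korobovSpace_sq _ hN, snoc_castLE_eq hd,
    dualSum_restrictWeights _ hd, initialSum_succ _ _ _ hd]
  congr 1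
  refine initialSum_congr _ fun j hj => Function.update_of_ne ?_ _ _
  exact fun H => by
    rw [H] at hj
    simp at hj

theorem lastSum_le_of_isCBCOutput {s N : ℕ} (hN : N ≠ 0) (γ : Weights s) {z : Fin s → ℕ}
    (hz : IsCBCOutput N (korobovCriterion γ N) z) (i : Fin s) {c : ℕ}
    (hc : c ∈ Finset.Icc 1 (N - 1)) :
    lastSum (sqrtModifiedWeights γ) 1 N z i
      ≤ lastSum (sqrtModifiedWeights γ) 1 N (Function.update z i c) i := by
  obtain ⟨d, hd⟩ := i
  have := (hz d hd).2 c hc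
  rw [korobovCriterion_snoc hN, korobovCriterion_snoc hN, Function.update_eq_self] at this
  refine (ENNReal.add_le_add_iff_left ?_).mp this
  exact ne_top_of_le_ne_top (dualSum_ne_top _ N z) (initialSum_le_dualSum _ _ _ _)

/-- Greedy choice, by induction on the number of components: the candidate set is finite and
contains 1, and changing component m affects no earlier criterion. -/
theorem exists_isCBCOutput {s N : ℕ} (hN : 2 ≤ N)
    (crit : (d : ℕ) → d ≤ s → (Fin d → ℕ) → ℝ≥0∞) : ∃ z : Fin s → ℕ, IsCBCOutput N crit z := by
  have key : ∀ m ≤ s, ∃ z : Fin s → ℕ, ∀ (d : ℕ) (hd : d < s), d < m →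
      z ⟨d, hd⟩ ∈ Finset.Icc 1 (N - 1) ∧ ∀ c ∈ Finset.Icc 1 (N - 1),
      crit (d + 1) hd (Fin.snoc (fun j => z (Fin.castLE hd.le j)) (z ⟨d, hd⟩)) ≤
        crit (d + 1) hd (Fin.snoc (fun j => z (Fin.castLE hd.le j)) c) := by
    intro m
    induction m with
    | zero => exact fun _ => ⟨0, fun d hd h => absurd h (by omega)⟩
    | succ m ih =>
      intro hm
      obtain ⟨z, hz⟩ := ih (by omega)
      obtain ⟨c₀, hc₀, hmin⟩ := Finset.exists_min_image (Finset.Icc 1 (N - 1))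
        (fun c => crit (m + 1) hm (Fin.snoc (fun j => z (Fin.castLE (by omega) j)) c))
        ⟨1, by simp; omega⟩
      refine ⟨Function.update z ⟨m, hm⟩ c₀, fun d hd hdm => ?_⟩
      have hpre : (fun j : Fin d => Function.update z ⟨m, hm⟩ c₀ (Fin.castLE hd.le j))
          = fun j => z (Fin.castLE hd.le j) := by
        funext j
        refine Function.update_of_ne (fun H => ?_) _ _
        have := congrArg Fin.val H
        simp at this
        omega
      rw [hpre]
      rcases (Nat.lt_succ_iff_lt_or_eq.mp hdm) with h | rfl
      · rw [Function.update_of_ne (fun H => by simp at H; omega)]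
        exact hz d hd h
      · rw [Function.update_self]
        exact ⟨hc₀, hmin⟩
  obtain ⟨z, hz⟩ := key s le_rfl
  exact ⟨z, fun d hd => hz d hd hd⟩

/-! ### The tent transformation on the circle -/

theorem unitAddCircle_norm_of_le_half {x : ℝ} (h0 : 0 ≤ x) (h1 : x ≤ 1 / 2) :
    ‖(x : UnitAddCircle)‖ = x := by
  have := (AddCircle.norm_coe_eq_abs_iff (p := (1 : ℝ)) (x := x) one_ne_zero).mpr (by
    rw [abs_of_nonneg h0, abs_one]
    exact h1)
  rw [abs_of_nonneg h0] at this
  exact this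

theorem unitAddCircle_norm_of_half_le {x : ℝ} (h0 : 1 / 2 ≤ x) (h1 : x ≤ 1) :
    ‖(x : UnitAddCircle)‖ = 1 - x := by
  rw [← norm_neg, ← unitAddCircle_norm_of_le_half (x := 1 - x) (by linarith) (by linarith)]
  congr 1
  rw [AddCircle.coe_sub, AddCircle.coe_period, zero_sub]

/-- The tent transformation as a map on the circle. -/
def tentCircle (u : UnitAddCircle) : I :=
  ⟨2 * ‖u‖, by positivity, by
    have := AddCircle.norm_le_half_period (1 : ℝ) one_ne_zero (x := u)
    rw [abs_one] at this
    linarith⟩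

theorem continuous_tentCircle : Continuous tentCircle :=
  (continuous_const.mul continuous_norm).subtype_mk _

theorem tent_eq_tentCircle (x : I) : tent x = tentCircle ((x : ℝ) : UnitAddCircle) := by
  refine Subtype.ext ?_
  simp only [tent, tentCircle]
  rcases le_total (x : ℝ) (1 / 2) with h | h
  · rw [unitAddCircle_norm_of_le_half x.2.1 h, abs_of_nonpos (by linarith)]
    ring
  · rw [unitAddCircle_norm_of_half_le h x.2.2, abs_of_nonneg (by linarith)]
    ring

/-- Fourier coefficients of a tent transformed function are cosine coefficients. -/
theorem integral_comp_tent_mul_fourier {h : ℝ → ℝ} (hh : Continuous h) (l : ℤ) :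
    ∫ u : UnitAddCircle, (h (2 * ‖u‖) : ℂ) * fourier l u
      = ((∫ t in (0 : ℝ)..1, h t * Real.cos (Real.pi * l * t) : ℝ) : ℂ) := by
  set F : UnitAddCircle → ℂ := fun u => (h (2 * ‖u‖) : ℂ) * fourier l u with hF
  have hFc : Continuous F :=
    (Complex.continuous_ofReal.comp (hh.comp (continuous_const.mul continuous_norm))).mul
      (fourier l).continuous
  have hFr : Continuous fun x : ℝ => F x := hFc.comp (AddCircle.continuous_mk' 1)
  have e0 := UnitAddCircle.intervalIntegral_preimage 0 F
  rw [zero_add] at e0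
  rw [← e0, ← intervalIntegral.integral_add_adjacent_intervals
    (hFr.intervalIntegrable 0 (1 / 2)) (hFr.intervalIntegrable (1 / 2) 1)]
  let E₁ : ℝ → ℂ := fun t => (h t : ℂ) * Complex.exp (Real.pi * l * t * Complex.I)
  let E₂ : ℝ → ℂ := fun t => (h t : ℂ) * Complex.exp (-(Real.pi * l * t * Complex.I))
  have hE₁ : Continuous E₁ := by fun_prop
  have hE₂ : Continuous E₂ := by fun_prop
  have i1 : ∫ x in (0 : ℝ)..1 / 2, F x = ∫ x in (0 : ℝ)..1 / 2, E₁ (2 * x) := by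
    refine intervalIntegral.integral_congr fun x hx => ?_
    rw [Set.uIcc_of_le (by norm_num)] at hx
    simp only [hF, E₁]
    rw [unitAddCircle_norm_of_le_half hx.1 hx.2, fourier_coe_apply]
    congr 2
    push_cast
    ring
  have i2 : ∫ x in (1 / 2 : ℝ)..1, F x = ∫ x in (1 / 2 : ℝ)..1, E₂ (2 - 2 * x) := by
    refine intervalIntegral.integral_congr fun x hx => ?_
    rw [Set.uIcc_of_le (by norm_num)] at hx
    simp only [hF, E₂]
    rw [unitAddCircle_norm_of_half_le hx.1 hx.2, fourier_coe_apply]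
    -- The exponents differ by the integer multiple -l of 2πi.
    have : Complex.exp (-(Real.pi * l * ((2 - 2 * x : ℝ) : ℂ) * Complex.I))
        = Complex.exp (2 * Real.pi * Complex.I * l * x / (1 : ℝ)) := by
      rw [Complex.exp_eq_exp_iff_exists_int]
      refine ⟨-l, ?_⟩
      push_cast
      ring
    rw [this, show 2 * (1 - x) = 2 - 2 * x by ring]
  -- Both halves of the circle become integrals over [0,1] with factor 1/2; the two conjugate
  -- exponentials average to the cosine.
  rw [i1, i2, intervalIntegral.integral_comp_mul_left _ two_ne_zero,
    intervalIntegral.integral_comp_sub_mul _ two_ne_zero]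
  norm_num only [mul_zero, mul_one, sub_self]
  rw [← smul_add, ← intervalIntegral.integral_add (hE₁.intervalIntegrable _ _)
    (hE₂.intervalIntegrable _ _), ← intervalIntegral.integral_smul, ← intervalIntegral.integral_ofReal]
  refine intervalIntegral.integral_congr fun t _ => ?_
  simp only [E₁, E₂, Complex.real_smul]
  push_cast
  rw [Complex.cos]
  simp only [neg_mul]
  ring

/-- This is frequency 0 of `integral_comp_tent_mul_fourier`, tested against bounded continuous
functions extended to the line by projection onto [0,1]. -/
theorem measurePreserving_tentCircle : MeasurePreserving tentCircle := by
  refine ⟨continuous_tentCircle.measurable, ?_⟩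
  refine ext_of_forall_integral_eq_of_IsFiniteMeasure fun f => ?_
  rw [integral_map continuous_tentCircle.aemeasurable f.continuous.aestronglyMeasurable]
  have hh : Continuous fun t : ℝ => f (Set.projIcc 0 1 zero_le_one t) :=
    f.continuous.comp continuous_projIcc
  have key := integral_comp_tent_mul_fourier hh 0
  simp only [fourier_zero, mul_one, Int.cast_zero, mul_zero, zero_mul, Real.cos_zero] at key
  rw [integral_complex_ofReal] at key
  have key' := Complex.ofReal_injective key
  have e : ∀ u, f (Set.projIcc 0 1 zero_le_one (2 * ‖u‖)) = f (tentCircle u) := by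
    intro u
    congr 1
    exact Set.projIcc_of_mem _ (tentCircle u).2
  simp only [e] at key'
  rw [key', ← integral_unitInterval_eq]
  simp

/-! ### The univariate kernel -/

theorem bernoulliFun_four (x : ℝ) : bernoulliFun 4 x = x ^ 4 - 2 * x ^ 3 + x ^ 2 - 1 / 30 := by
  simp [bernoulliFun, Polynomial.bernoulli_def, Finset.sum_range_succ,
    bernoulli_eq_bernoulli'_of_ne_one]
  norm_num [Nat.choose]
  ring

theorem hasDerivAt_quartic (a₀ a₁ a₂ a₃ a₄ c t : ℝ) :
    HasDerivAt (fun τ => a₀ + a₁ * (τ - c) + a₂ * (τ - c) ^ 2 + a₃ * (τ - c) ^ 3 + a₄ * (τ - c) ^ 4)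
      (a₁ + 2 * a₂ * (t - c) + 3 * a₃ * (t - c) ^ 2 + 4 * a₄ * (t - c) ^ 3) t := by
  have h : HasDerivAt (fun τ : ℝ => τ - c) 1 t := (hasDerivAt_id t).sub_const c
  have := ((((hasDerivAt_const t a₀).add (h.const_mul a₁)).add ((h.pow 2).const_mul a₂)).add
    ((h.pow 3).const_mul a₃)).add ((h.pow 4).const_mul a₄)
  refine (this.congr_deriv ?_)
  norm_num
  ring

/-- A primitive of a quartic polynomial in `t - c` times `cos (p t)`. -/
def cosPrimitive (a₀ a₁ a₂ a₃ a₄ c p t : ℝ) : ℝ :=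
  (a₀ + a₁ * (t - c) + a₂ * (t - c) ^ 2 + a₃ * (t - c) ^ 3 + a₄ * (t - c) ^ 4) * Real.sin (p * t) / p
  + (a₁ + 2 * a₂ * (t - c) + 3 * a₃ * (t - c) ^ 2 + 4 * a₄ * (t - c) ^ 3) * Real.cos (p * t) / p ^ 2
  - (2 * a₂ + 6 * a₃ * (t - c) + 12 * a₄ * (t - c) ^ 2) * Real.sin (p * t) / p ^ 3
  - (6 * a₃ + 24 * a₄ * (t - c)) * Real.cos (p * t) / p ^ 4
  + 24 * a₄ * Real.sin (p * t) / p ^ 5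

/-- Repeated integration by parts ends after the fourth derivative. The centre c is kept free so
that expansions about the diagonal point fit directly. -/
theorem integral_quartic_mul_cos (a₀ a₁ a₂ a₃ a₄ c : ℝ) {p : ℝ} (hp : p ≠ 0) (a b : ℝ) :
    ∫ t in a..b, (a₀ + a₁ * (t - c) + a₂ * (t - c) ^ 2 + a₃ * (t - c) ^ 3 + a₄ * (t - c) ^ 4)
      * Real.cos (p * t)
      = cosPrimitive a₀ a₁ a₂ a₃ a₄ c p b - cosPrimitive a₀ a₁ a₂ a₃ a₄ c p a := by
  refine intervalIntegral.integral_eq_sub_of_hasDerivAt (fun t _ => ?_)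
    (Continuous.intervalIntegrable (by fun_prop) _ _)
  have hpt : HasDerivAt (fun τ : ℝ => p * τ) p t := by
    simpa using (hasDerivAt_id t).const_mul p
  have hs := hpt.sin
  have hc := hpt.cos
  have q0 := hasDerivAt_quartic a₀ a₁ a₂ a₃ a₄ c t
  have q1 := hasDerivAt_quartic a₁ (2 * a₂) (3 * a₃) (4 * a₄) 0 c t
  have q2 := hasDerivAt_quartic (2 * a₂) (6 * a₃) (12 * a₄) 0 0 c t
  have q3 := hasDerivAt_quartic (6 * a₃) (24 * a₄) 0 0 0 c t
  have := (((((q0.mul hs).div_const p).add ((q1.mul hc).div_const (p ^ 2))).sub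
    ((q2.mul hs).div_const (p ^ 3))).sub ((q3.mul hc).div_const (p ^ 4))).add
    ((hs.const_mul (24 * a₄)).div_const (p ^ 5))
  refine (this.congr_deriv ?_).congr_of_eventuallyEq (Filter.Eventually.of_forall fun τ => ?_)
  · field_simp
    ring
  · simp only [cosPrimitive, Pi.add_apply, Pi.sub_apply, Pi.mul_apply]
    ring

theorem integral_quartic (a₀ a₁ a₂ a₃ a₄ c a b : ℝ) :
    ∫ t in a..b, (a₀ + a₁ * (t - c) + a₂ * (t - c) ^ 2 + a₃ * (t - c) ^ 3 + a₄ * (t - c) ^ 4)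
      = (a₀ * (b - c) + a₁ * (b - c) ^ 2 / 2 + a₂ * (b - c) ^ 3 / 3 + a₃ * (b - c) ^ 4 / 4
          + a₄ * (b - c) ^ 5 / 5)
        - (a₀ * (a - c) + a₁ * (a - c) ^ 2 / 2 + a₂ * (a - c) ^ 3 / 3 + a₃ * (a - c) ^ 4 / 4
          + a₄ * (a - c) ^ 5 / 5) := by
  refine intervalIntegral.integral_eq_sub_of_hasDerivAt (f := fun t => a₀ * (t - c)
    + a₁ * (t - c) ^ 2 / 2 + a₂ * (t - c) ^ 3 / 3 + a₃ * (t - c) ^ 4 / 4 + a₄ * (t - c) ^ 5 / 5)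
    (fun t _ => ?_) (Continuous.intervalIntegrable (by fun_prop) _ _)
  have h : HasDerivAt (fun τ : ℝ => τ - c) 1 t := (hasDerivAt_id t).sub_const c
  have := ((((h.const_mul a₀).add (((h.pow 2).const_mul a₁).div_const 2)).add
    (((h.pow 3).const_mul a₂).div_const 3)).add
    (((h.pow 4).const_mul a₃).div_const 4)).add (((h.pow 5).const_mul a₄).div_const 5)
  refine (this.congr_deriv ?_)
  norm_num
  ring

/-- The univariate kernel without its constant term, on the real line. -/
def centeredKernel (t τ : ℝ) : ℝ :=
  (t - 1 / 2) * (τ - 1 / 2) + (t ^ 2 - t + 1 / 6) * (τ ^ 2 - τ + 1 / 6) / 4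
    - (|t - τ| ^ 4 - 2 * |t - τ| ^ 3 + |t - τ| ^ 2 - 1 / 30) / 24

theorem centeredKernel_eq (x y : I) :
    -1 + sobolevKernel₁ 2 x y = centeredKernel x y := by
  rw [sobolevKernel₁, centeredKernel, Finset.sum_Icc_succ_top (by norm_num), Finset.Icc_self,
    Finset.sum_singleton]
  norm_num [bernoulliFun_one, bernoulliFun_two, bernoulliFun_four, Nat.factorial]
  ring

theorem continuous_centeredKernel : Continuous fun p : ℝ × ℝ => centeredKernel p.1 p.2 := by
  unfold centeredKernel
  fun_prop

/-- The cosine coefficients of the centered kernel in the second variable. -/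
def kernelCoeff (l : ℤ) (t : ℝ) : ℝ :=
  ∫ τ in (0 : ℝ)..1, centeredKernel t τ * Real.cos (Real.pi * l * τ)

/-- On either side of τ = t the kernel is a quartic in τ - t. The two quartics differ only in the
sign of the cubic term, which comes from |t - τ|^3; 1/720 is the constant (1/30)/24 of B_4/4!. -/
theorem integral_centeredKernel_mul {c : ℝ → ℝ} (hc : Continuous c) {t : ℝ}
    (ht : t ∈ Set.Icc (0 : ℝ) 1) :
    ∫ τ in (0 : ℝ)..1, centeredKernel t τ * c τ
      = (∫ τ in (0 : ℝ)..t, ((t - 1 / 2) * (t - 1 / 2) + (t ^ 2 - t + 1 / 6) ^ 2 / 4 + 1 / 720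
          + ((t - 1 / 2) + (t ^ 2 - t + 1 / 6) * (2 * t - 1) / 4) * (τ - t)
          + ((t ^ 2 - t + 1 / 6) / 4 - 1 / 24) * (τ - t) ^ 2 + (-1 / 12) * (τ - t) ^ 3
          + (-1 / 24) * (τ - t) ^ 4) * c τ)
        + ∫ τ in t..1, ((t - 1 / 2) * (t - 1 / 2) + (t ^ 2 - t + 1 / 6) ^ 2 / 4 + 1 / 720
          + ((t - 1 / 2) + (t ^ 2 - t + 1 / 6) * (2 * t - 1) / 4) * (τ - t)
          + ((t ^ 2 - t + 1 / 6) / 4 - 1 / 24) * (τ - t) ^ 2 + (1 / 12) * (τ - t) ^ 3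
          + (-1 / 24) * (τ - t) ^ 4) * c τ := by
  have hcont : Continuous fun τ => centeredKernel t τ * c τ :=
    (continuous_centeredKernel.comp (Continuous.prodMk_right t)).mul hc
  rw [← intervalIntegral.integral_add_adjacent_intervals
    (hcont.intervalIntegrable 0 t) (hcont.intervalIntegrable t 1)]
  congr 1
  · refine intervalIntegral.integral_congr fun τ hτ => ?_
    rw [Set.uIcc_of_le ht.1] at hτ
    simp only [centeredKernel]
    rw [abs_of_nonneg (by linarith [hτ.2])]
    ring
  · refine intervalIntegral.integral_congr fun τ hτ => ?_
    rw [Set.uIcc_of_le ht.2] at hτ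
    simp only [centeredKernel]
    rw [abs_of_nonpos (by linarith [hτ.1])]
    ring

/-- The kernel has mean zero in each variable, so a coordinate on which the kernel depends but the
frequency does not kills the whole product. -/
theorem kernelCoeff_zero {t : ℝ} (ht : t ∈ Set.Icc (0 : ℝ) 1) : kernelCoeff 0 t = 0 := by
  rw [kernelCoeff, integral_centeredKernel_mul (by fun_prop) ht]
  simp only [Int.cast_zero, mul_zero, zero_mul, Real.cos_zero, mul_one, integral_quartic]
  ring

theorem sin_pi_mul_int (l : ℤ) : Real.sin (Real.pi * l) = 0 := by
  rw [mul_comm]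
  exact Real.sin_int_mul_pi l

/-- Since sin p = 0 the boundary sines drop out; cos p = ±1 stays symbolic, so even and odd l are
treated together. -/
theorem kernelCoeff_eq {l : ℤ} (hl : l ≠ 0) {t : ℝ} (ht : t ∈ Set.Icc (0 : ℝ) 1) {p : ℝ}
    (hp : p = Real.pi * l) :
    kernelCoeff l t = (t - 1 / 2) * (Real.cos p - 1) / p ^ 2
      + (t ^ 2 - t + 1 / 6) * (Real.cos p + 1) / (4 * p ^ 2) + Real.cos (p * t) / p ^ 4
      - (1 - Real.cos p) / 24 * ((4 * t ^ 3 - 6 * t ^ 2 + 2 * t) / p ^ 2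
        - (24 * t - 12) / p ^ 4) := by
  have hp0 : p ≠ 0 := by
    rw [hp]
    exact mul_ne_zero Real.pi_ne_zero (by exact_mod_cast hl)
  have hsin : Real.sin p = 0 := by
    rw [hp]
    exact sin_pi_mul_int l
  rw [kernelCoeff, integral_centeredKernel_mul (by fun_prop) ht]
  simp only [← hp]
  rw [integral_quartic_mul_cos _ _ _ _ _ _ hp0, integral_quartic_mul_cos _ _ _ _ _ _ hp0]
  simp only [cosPrimitive, mul_one, mul_zero, Real.sin_zero, Real.cos_zero, hsin, sub_self]
  field_simp
  ring

/-- The diagonal cosine coefficients of the centered kernel. -/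
theorem integral_kernelCoeff_mul_cos {l : ℤ} (hl : l ≠ 0) {p : ℝ} (hp : p = Real.pi * l) :
    ∫ t in (0 : ℝ)..1, kernelCoeff l t * Real.cos (Real.pi * l * t)
      = (Real.cos p - 1) ^ 2 / p ^ 4 + (Real.cos p + 1) ^ 2 / (4 * p ^ 4) + 1 / (2 * p ^ 4)
        + (1 - Real.cos p) ^ 2 / 24 * (2 / p ^ 4 - 48 / p ^ 6) := by
  have hp0 : p ≠ 0 := by
    rw [hp]
    exact mul_ne_zero Real.pi_ne_zero (by exact_mod_cast hl)
  have hsin : Real.sin p = 0 := by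
    rw [hp]
    exact sin_pi_mul_int l
  have hcos : ∫ t in (0 : ℝ)..1, Real.cos (p * t) * Real.cos (p * t) = 1 / 2 := by
    have hd : ∀ t ∈ Set.uIcc (0 : ℝ) 1, HasDerivAt
        (fun t => t / 2 + Real.sin (p * t) * Real.cos (p * t) / (2 * p))
        (Real.cos (p * t) * Real.cos (p * t)) t := by
      intro t _
      have hpt : HasDerivAt (fun τ : ℝ => p * τ) p t := by
        simpa using (hasDerivAt_id t).const_mul p
      have := ((hasDerivAt_id t).div_const 2).add ((hpt.sin.mul hpt.cos).div_const (2 * p))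
      refine this.congr_deriv ?_
      field_simp
      linear_combination -Real.sin_sq_add_cos_sq (p * t)
    rw [intervalIntegral.integral_eq_sub_of_hasDerivAt hd
      (Continuous.intervalIntegrable (by fun_prop) _ _)]
    simp [hsin]
  -- The coefficient is a cubic in t plus cos(pt)/p^4. The cubic fits `integral_quartic_mul_cos`;
  -- the other term needs the integral of cos², which is 1/2.
  have hsplit : ∫ t in (0 : ℝ)..1, kernelCoeff l t * Real.cos (Real.pi * l * t)
      = (∫ t in (0 : ℝ)..1, ((-1 / 2 * (Real.cos p - 1) / p ^ 2
          + 1 / 6 * (Real.cos p + 1) / (4 * p ^ 2) - (1 - Real.cos p) / 24 * (12 / p ^ 4))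
        + ((Real.cos p - 1) / p ^ 2 - (Real.cos p + 1) / (4 * p ^ 2)
          - (1 - Real.cos p) / 24 * (2 / p ^ 2 - 24 / p ^ 4)) * (t - 0)
        + ((Real.cos p + 1) / (4 * p ^ 2) + (1 - Real.cos p) / 24 * (6 / p ^ 2)) * (t - 0) ^ 2
        + (-(1 - Real.cos p) / 24 * (4 / p ^ 2)) * (t - 0) ^ 3 + 0 * (t - 0) ^ 4)
        * Real.cos (p * t))
        + ∫ t in (0 : ℝ)..1, 1 / p ^ 4 * (Real.cos (p * t) * Real.cos (p * t)) := by
    rw [← intervalIntegral.integral_add (Continuous.intervalIntegrable (by fun_prop) _ _)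
      (Continuous.intervalIntegrable (by fun_prop) _ _)]
    refine intervalIntegral.integral_congr fun t ht => ?_
    rw [Set.uIcc_of_le zero_le_one] at ht
    simp only [kernelCoeff_eq hl ht hp, ← hp]
    ring
  rw [hsplit, intervalIntegral.integral_const_mul, hcos, integral_quartic_mul_cos _ _ _ _ _ _ hp0]
  simp only [cosPrimitive, mul_one, mul_zero, Real.sin_zero, Real.cos_zero, hsin, sub_self]
  field_simp
  ring

/-- With p = πl, the value is (3/2)/p^4 for cos p = 1 and (29/6)/p^4 - 8/p^6 for cos p = -1. The
second case is the source of c' = 4 · 29/6; p² ≥ 1 keeps the subtracted term harmless for the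
absolute value. -/
theorem abs_integral_kernelCoeff_mul_cos_le {l : ℤ} (hl : l ≠ 0) :
    |∫ t in (0 : ℝ)..1, kernelCoeff l t * Real.cos (Real.pi * l * t)|
      ≤ 29 / 6 / (Real.pi * l) ^ 4 := by
  rw [integral_kernelCoeff_mul_cos hl rfl]
  set p := Real.pi * l with hp
  have hl1 : (1 : ℝ) ≤ (l : ℝ) ^ 2 := by
    have : 1 ≤ l ^ 2 := by
      have := sq_pos_of_ne_zero hl
      omega
    exact_mod_cast this
  have hp1 : 1 ≤ p ^ 2 := by
    rw [hp, mul_pow]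
    nlinarith [Real.pi_gt_three]
  have hsq : Real.cos p ^ 2 = 1 := by
    have := Real.sin_sq_add_cos_sq p
    rw [hp, sin_pi_mul_int] at this
    rw [hp]
    linarith
  have h4 : 0 < 1 / p ^ 4 := by positivity
  have h6 : 0 < 1 / p ^ 6 := by positivity
  have h64 : 1 / p ^ 6 ≤ 1 / p ^ 4 :=
    one_div_le_one_div_of_le (by positivity) (by nlinarith [sq_nonneg (p ^ 2)])
  have e1 : 29 / 6 / p ^ 4 = 29 / 6 * (1 / p ^ 4) := by ring
  rw [e1, abs_le]
  rcases eq_or_eq_neg_of_sq_eq_sq _ _ (hsq.trans (one_pow 2).symm) with h | h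
  · rw [h]
    have : ((1 : ℝ) - 1) ^ 2 / p ^ 4 + (1 + 1) ^ 2 / (4 * p ^ 4) + 1 / (2 * p ^ 4)
        + (1 - 1) ^ 2 / 24 * (2 / p ^ 4 - 48 / p ^ 6) = 3 / 2 * (1 / p ^ 4) := by
      ring
    rw [this]
    constructor <;> linarith
  · rw [h]
    have : ((-1 : ℝ) - 1) ^ 2 / p ^ 4 + (-1 + 1) ^ 2 / (4 * p ^ 4) + 1 / (2 * p ^ 4)
        + (1 - -1) ^ 2 / 24 * (2 / p ^ 4 - 48 / p ^ 6)
        = 29 / 6 * (1 / p ^ 4) - 8 * (1 / p ^ 6) := by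
      field_simp
      ring
    rw [this]
    constructor <;> linarith

/-! ### Fourier coefficients of tent transformed Sobolev functions -/

instance isProbabilityMeasure_unitAddCircle :
    IsProbabilityMeasure (volume : Measure UnitAddCircle) := ⟨UnitAddCircle.measure_univ⟩

/-- On a circle of length 1, normalized Haar measure and `volume` coincide. -/
theorem mFourierCoeff_eq_integral_volume {s : ℕ} (F : UnitAddTorus (Fin s) → ℂ) (n : Fin s → ℤ) :
    UnitAddTorus.mFourierCoeff F n
      = ∫ t : UnitAddTorus (Fin s), UnitAddTorus.mFourier (-n) t * F t := by
  have h : (AddCircle.haarAddCircle : Measure UnitAddCircle) = volume := by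
    rw [AddCircle.volume_eq_smul_haarAddCircle]
    simp
  have h2 : UnitAddTorus.mFourierCoeff F n
      = ∫ t, UnitAddTorus.mFourier (-n) t * F t
        ∂(Measure.pi fun _ : Fin s => (AddCircle.haarAddCircle : Measure UnitAddCircle)) := rfl
  rw [h2, h]
  rfl

/-- The tent transformation as a map on the torus. -/
def tentTorus {s : ℕ} (u : UnitAddTorus (Fin s)) : Cube s := fun j => tentCircle (u j)

theorem continuous_tentTorus {s : ℕ} : Continuous (tentTorus (s := s)) :=
  continuous_pi fun j => continuous_tentCircle.comp (continuous_apply j)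

theorem measurePreserving_tentTorus {s : ℕ} : MeasurePreserving (tentTorus (s := s)) :=
  measurePreserving_pi _ _ fun _ => measurePreserving_tentCircle

theorem integral_comp_tentTorus {s : ℕ} {f : Cube s → ℝ} (hf : Continuous f) :
    ∫ u, f (tentTorus u) = ∫ x, f x := by
  rw [← (measurePreserving_tentTorus (s := s)).map_eq,
    integral_map continuous_tentTorus.aemeasurable hf.aestronglyMeasurable]

theorem integral_fourier_unitAddCircle (l : ℤ) :
    ∫ u : UnitAddCircle, (fourier l u : ℂ) = if l = 0 then 1 else 0 := by
  have h := integral_comp_tent_mul_fourier (continuous_const (y := (1 : ℝ))) l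
  simp only [Complex.ofReal_one, one_mul] at h
  rw [h]
  split_ifs with hl
  · simp [hl]
  · have hp : Real.pi * l ≠ 0 := mul_ne_zero Real.pi_ne_zero (by exact_mod_cast hl)
    have := integral_quartic_mul_cos 1 0 0 0 0 0 hp 0 1
    simp only [zero_mul, add_zero] at this
    simp only [one_mul] at this
    rw [this]
    simp [cosPrimitive, sin_pi_mul_int]

theorem continuous_kernelCoeff (l : ℤ) : Continuous (kernelCoeff l) := by
  unfold kernelCoeff
  refine intervalIntegral.continuous_parametric_intervalIntegral_of_continuous' ?_ _ _
  exact continuous_centeredKernel.mul (by fun_prop)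

/-! ### Double Fourier integrals of the Sobolev kernel and the resulting error bound. -/

section
variable {s : ℕ} (γ : Weights s)

theorem kernel_sobolevSpace (x y : Cube s) :
    RKHS.kernel (SobolevSpace 2 γ) x y (1 : ℝ) = sobolevKernel 2 γ x y := by
  rw [RKHS.OfKernel.kernel_ofKernel]
  simp [kernelMatrix]

theorem sobolevKernel_eq (x y : Cube s) :
    sobolevKernel 2 γ x y = 1 + ∑ A : Finset (Fin s) with A.Nonempty,
      γ A * ∏ j ∈ A, centeredKernel (x j) (y j) := by
  simp only [sobolevKernel, centeredKernel_eq]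

theorem continuous_sobolevKernel :
    Continuous fun p : Cube s × Cube s =>
      RKHS.kernel (SobolevSpace 2 γ) p.1 p.2 (1 : ℝ) := by
  simp only [kernel_sobolevSpace, sobolevKernel_eq]
  refine continuous_const.add (continuous_finsetSum _ fun A _ => continuous_const.mul
    (continuous_finsetProd _ fun j _ => ?_))
  refine continuous_centeredKernel.comp (f := fun p : Cube s × Cube s =>
    (((p.1 j : I) : ℝ), ((p.2 j : I) : ℝ))) ?_
  fun_prop

theorem prod_filter_ne_zero {M : Type*} [CommMonoid M] (n : Fin s → ℤ) (a : Fin s → M) :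
    ∏ j, (if n j = 0 then 1 else a j) = ∏ j with n j ≠ 0, a j := by
  rw [Finset.prod_filter]
  refine Finset.prod_congr rfl fun j _ => ?_
  by_cases h : n j = 0 <;> simp [h]

/-- Each summand of the kernel factors over coordinates. For a subset A other than the support of n
some factor vanishes: `kernelCoeff_zero` if j ∈ A and n_j = 0, the mean of a nontrivial character if
j ∉ A and n_j ≠ 0. The constant 1 of the kernel is the case A = ∅. -/
theorem integral_sobolevKernel_mul_mFourier {n : Fin s → ℤ} (hn : n ≠ 0)
    (u : UnitAddTorus (Fin s)) :
    ∫ v : UnitAddTorus (Fin s), (sobolevKernel 2 γ (tentTorus v) (tentTorus u) : ℂ)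
        * UnitAddTorus.mFourier n v
      = ((γ {j | n j ≠ 0} * ∏ j with n j ≠ 0, kernelCoeff (n j) (2 * ‖u j‖) : ℝ) : ℂ) := by
  set a : Finset (Fin s) → (j : Fin s) → UnitAddCircle → ℂ := fun A j v =>
    if j ∈ A then (centeredKernel (2 * ‖u j‖) (2 * ‖v‖) : ℂ) * fourier (n j) v
      else fourier (n j) v with ha
  have hac : ∀ A j, Continuous (a A j) := by
    intro A j
    simp only [ha]
    split_ifs
    · refine Continuous.mul (Complex.continuous_ofReal.comp (continuous_centeredKernel.comp
        (f := fun v : UnitAddCircle => (2 * ‖u j‖, 2 * ‖v‖)) (by fun_prop))) (fourier _).continuous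
    · exact (fourier _).continuous
  have hsymm : ∀ t τ, centeredKernel t τ = centeredKernel τ t := by
    intro t τ
    simp only [centeredKernel]
    rw [abs_sub_comm]
    ring
  have hexp : ∀ v : UnitAddTorus (Fin s),
      (sobolevKernel 2 γ (tentTorus v) (tentTorus u) : ℂ) * UnitAddTorus.mFourier n v
      = ∏ j, a ∅ j (v j) + ∑ A : Finset (Fin s) with A.Nonempty, (γ A : ℂ) * ∏ j, a A j (v j) := by
    intro v
    rw [sobolevKernel_eq]
    push_cast
    rw [add_mul, one_mul, Finset.sum_mul]
    congr 1
    refine Finset.sum_congr rfl fun A _ => ?_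
    rw [mul_assoc]
    congr 1
    have : ∏ j ∈ A, (centeredKernel (tentTorus v j) (tentTorus u j) : ℂ)
        = ∏ j, (if j ∈ A then (centeredKernel (2 * ‖u j‖) (2 * ‖v j‖) : ℂ) else 1) := by
      rw [Finset.prod_ite_mem, Finset.univ_inter]
      refine Finset.prod_congr rfl fun j _ => ?_
      rw [hsymm]
      rfl
    rw [this, UnitAddTorus.mFourier, ContinuousMap.coe_mk, ← Finset.prod_mul_distrib]
    refine Finset.prod_congr rfl fun j _ => ?_
    simp only [ha]
    split_ifs <;> simp
  have hint : ∀ A j, ∫ v, a A j v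
      = if j ∈ A then (kernelCoeff (n j) (2 * ‖u j‖) : ℂ) else if n j = 0 then 1 else 0 := by
    intro A j
    simp only [ha]
    by_cases hj : j ∈ A
    · simp only [hj, if_true]
      exact integral_comp_tent_mul_fourier
        (continuous_centeredKernel.comp (Continuous.prodMk_right (2 * ‖u j‖))) (n j)
    · simp only [hj, if_false]
      exact integral_fourier_unitAddCircle (n j)
  have hpc : ∀ A, Continuous fun v : UnitAddTorus (Fin s) => ∏ j, a A j (v j) := fun A =>
    continuous_finsetProd _ fun j _ => (hac A j).comp (continuous_apply j)
  have hpi : ∀ A, ∫ v : UnitAddTorus (Fin s), ∏ j, a A j (v j) = ∏ j, ∫ v, a A j v := fun A =>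
    integral_fintype_prod_volume_eq_prod (a A)
  simp only [hexp]
  rw [integral_add (integrable_of_continuous _ (hpc _)) (integrable_finsetSum _ fun A _ =>
    (integrable_of_continuous _ (hpc A)).const_mul _), integral_finsetSum _ fun A _ =>
    (integrable_of_continuous _ (hpc A)).const_mul _]
  simp only [integral_const_mul, hpi, hint]
  obtain ⟨i, hi⟩ := Function.ne_iff.mp hn
  have hi' : n i ≠ 0 := by simpa using hi
  have hz : ∀ A : Finset (Fin s), A ≠ ({j | n j ≠ 0} : Finset (Fin s)) →
      (∏ j, if j ∈ A then (kernelCoeff (n j) (2 * ‖u j‖) : ℂ) else if n j = 0 then 1 else 0)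
        = 0 := by
    intro A hA
    have : ∃ j, ¬ (j ∈ A ↔ n j ≠ 0) := by
      by_contra hc
      push Not at hc
      exact hA (by ext j; simpa using hc j)
    obtain ⟨j, hj⟩ := this
    refine Finset.prod_eq_zero (Finset.mem_univ j) ?_
    by_cases hjA : j ∈ A
    · have h0 : n j = 0 := by
        by_contra hc
        exact hj ⟨fun _ => hc, fun _ => hjA⟩
      rw [if_pos hjA, h0, kernelCoeff_zero (t := 2 * ‖u j‖) (tentCircle (u j)).2, Complex.ofReal_zero]
    · have h0 : n j ≠ 0 := by
        intro hc
        exact hj ⟨fun h => absurd h hjA, fun h => absurd hc h⟩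
      rw [if_neg hjA, if_neg h0]
  rw [hz ∅ (fun h => by
    have : i ∈ (∅ : Finset (Fin s)) := by rw [h]; simpa using hi'
    simp at this), zero_add,
    Finset.sum_eq_single_of_mem ({j | n j ≠ 0} : Finset (Fin s))]
  · push_cast
    congr 1
    rw [← prod_filter_ne_zero]
    refine Finset.prod_congr rfl fun j _ => ?_
    by_cases h : n j = 0 <;> simp [h]
  · simp only [Finset.mem_filter, Finset.mem_univ, true_and]
    exact ⟨i, by simpa using hi'⟩
  · intro A _ hA
    rw [hz A hA, mul_zero]

/-- Integrating the second variable against the same character leaves only diagonal cosine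
coefficients. -/
theorem integral_prod_kernelCoeff_mul_mFourier (n : Fin s → ℤ) :
    ∫ u : UnitAddTorus (Fin s),
      ((γ {j | n j ≠ 0} * ∏ j with n j ≠ 0, kernelCoeff (n j) (2 * ‖u j‖) : ℝ) : ℂ)
        * UnitAddTorus.mFourier n u
      = ((γ {j | n j ≠ 0} * ∏ j with n j ≠ 0,
        ∫ t in (0 : ℝ)..1, kernelCoeff (n j) t * Real.cos (Real.pi * n j * t) : ℝ) : ℂ) := by
  set b : (j : Fin s) → UnitAddCircle → ℂ := fun j u =>
    (if n j = 0 then 1 else (kernelCoeff (n j) (2 * ‖u‖) : ℂ)) * fourier (n j) u with hb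
  have hexp : ∀ u : UnitAddTorus (Fin s),
      ((γ {j | n j ≠ 0} * ∏ j with n j ≠ 0, kernelCoeff (n j) (2 * ‖u j‖) : ℝ) : ℂ)
        * UnitAddTorus.mFourier n u = (γ {j | n j ≠ 0} : ℂ) * ∏ j, b j (u j) := by
    intro u
    simp only [hb]
    rw [Finset.prod_mul_distrib, prod_filter_ne_zero, ← mul_assoc]
    push_cast
    rfl
  simp only [hexp]
  rw [integral_const_mul, integral_fintype_prod_volume_eq_prod b]
  push_cast
  rw [← prod_filter_ne_zero]
  congr 1
  refine Finset.prod_congr rfl fun j _ => ?_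
  simp only [hb]
  split_ifs with h
  · simp only [one_mul]
    rw [integral_fourier_unitAddCircle, if_pos h]
  · rw [integral_comp_tent_mul_fourier (continuous_kernelCoeff (n j))]

/-- Here the constants meet: c'/(4π^4) = (29/6)/π^4 per coordinate, and squaring undoes the root of
the weights. -/
theorem korobovCoeff_sqrtModifiedWeights_sq {n : Fin s → ℤ} (hn : n ≠ 0) :
    korobovCoeff 1 (sqrtModifiedWeights γ) n ^ 2
      = γ {j | n j ≠ 0} * ∏ j with n j ≠ 0, 29 / 6 / (Real.pi * n j) ^ 4 := by
  rw [korobovCoeff, if_neg hn, mul_pow, sqrtModifiedWeights, ← NNReal.coe_pow, NNReal.sq_sqrt,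
    ← Finset.prod_pow]
  push_cast
  rw [mul_assoc, ← Finset.prod_const, ← Finset.prod_mul_distrib]
  congr 1
  refine Finset.prod_congr rfl fun j hj => ?_
  have hj0 : (n j : ℝ) ≠ 0 := by
    have : n j ≠ 0 := by simpa using hj
    exact_mod_cast this
  rw [mul_one, Real.rpow_neg (abs_nonneg _), show (2 : ℝ) = ((2 : ℕ) : ℝ) by norm_num,
    Real.rpow_natCast, sq_abs, cPrime]
  have := Real.pi_ne_zero
  push_cast
  rw [NNReal.coe_real_pi]
  field_simp
  norm_num

/-- The Fourier coefficients of a tent transformed Sobolev function are dominated by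
the Korobov coefficients. -/
theorem norm_integral_mFourier_mul_le {n : Fin s → ℤ} (hn : n ≠ 0) (f : SobolevSpace 2 γ) :
    ‖∫ u : UnitAddTorus (Fin s), UnitAddTorus.mFourier n u * (f (tentTorus u) : ℂ)‖
      ≤ ‖f‖ * korobovCoeff 1 (sqrtModifiedWeights γ) n := by
  have hk := continuous_sobolevKernel γ
  have hfc := (continuous_of_continuous_kernel hk f).comp continuous_tentTorus
  have hre : Continuous fun u => (UnitAddTorus.mFourier n u).re :=
    Complex.continuous_re.comp (UnitAddTorus.mFourier n).continuous
  have him : Continuous fun u => (UnitAddTorus.mFourier n u).im :=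
    Complex.continuous_im.comp (UnitAddTorus.mFourier n).continuous
  have hKc : ∀ u, Continuous fun v => sobolevKernel 2 γ (tentTorus v) (tentTorus u) := by
    intro u
    have := hk.comp ((continuous_tentTorus (s := s)).prodMk (continuous_const (y := tentTorus u)))
    simpa only [Function.comp_def, kernel_sobolevSpace] using this
  set Γ : UnitAddTorus (Fin s) → ℝ := fun u =>
    γ {j | n j ≠ 0} * ∏ j with n j ≠ 0, kernelCoeff (n j) (2 * ‖u j‖) with hΓ
  have hΓc : Continuous Γ := continuous_const.mul (continuous_finsetProd _ fun j _ =>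
    (continuous_kernelCoeff (n j)).comp (continuous_const.mul
      (continuous_norm.comp (continuous_apply j))))
  have hin : ∀ u, (∫ v, (sobolevKernel 2 γ (tentTorus v) (tentTorus u) : ℂ)
      * UnitAddTorus.mFourier n v) = (Γ u : ℂ) :=
    fun u => integral_sobolevKernel_mul_mFourier γ hn u
  have hinI : ∀ u, Integrable fun v => (sobolevKernel 2 γ (tentTorus v) (tentTorus u) : ℂ)
      * UnitAddTorus.mFourier n v := fun u => integrable_of_continuous _
    ((Complex.continuous_ofReal.comp (hKc u)).mul (UnitAddTorus.mFourier n).continuous)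
  have hinre : ∀ u, ∫ v, (UnitAddTorus.mFourier n v).re
      * sobolevKernel 2 γ (tentTorus v) (tentTorus u) = Γ u := by
    intro u
    have h1 := integral_re (hinI u)
    simp only [RCLike.re_eq_complex_re, Complex.re_ofReal_mul] at h1
    rw [hin u, Complex.ofReal_re] at h1
    rw [← h1]
    exact integral_congr_ae (Filter.Eventually.of_forall fun v => mul_comm _ _)
  have hinim : ∀ u, ∫ v, (UnitAddTorus.mFourier n v).im
      * sobolevKernel 2 γ (tentTorus v) (tentTorus u) = 0 := by
    intro u
    have h1 := integral_im (hinI u)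
    simp only [RCLike.im_eq_complex_im, Complex.im_ofReal_mul] at h1
    rw [hin u, Complex.ofReal_im] at h1
    rw [← h1]
    exact integral_congr_ae (Filter.Eventually.of_forall fun v => mul_comm _ _)
  -- The Hilbert space is real, so the real and imaginary parts of the coefficient get separate
  -- representers.
  set ξ := integralRep volume (SobolevSpace 2 γ) tentTorus
    (fun u => (UnitAddTorus.mFourier n u).re) with hξ
  set η := integralRep volume (SobolevSpace 2 γ) tentTorus
    (fun u => (UnitAddTorus.mFourier n u).im) with hη
  -- The tent map is even on the circle, so the inner integral is real and the sine part contributes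
  -- nothing.
  have hη0 : η = 0 := by
    have : ‖η‖ ^ 2 = 0 := by
      rw [hη, norm_sq_integralRep _ hk continuous_tentTorus him]
      simp only [kernel_sobolevSpace, mul_assoc, integral_const_mul, hinim, mul_zero,
        integral_zero]
    simpa using this
  have hξn : ‖ξ‖ ^ 2 ≤ korobovCoeff 1 (sqrtModifiedWeights γ) n ^ 2 := by
    rw [hξ, norm_sq_integralRep _ hk continuous_tentTorus hre]
    simp only [kernel_sobolevSpace, mul_assoc, integral_const_mul, hinre]
    have hI : Integrable fun u => (Γ u : ℂ) * UnitAddTorus.mFourier n u :=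
      integrable_of_continuous _ ((Complex.continuous_ofReal.comp hΓc).mul
        (UnitAddTorus.mFourier n).continuous)
    have h1 := integral_re hI
    simp only [RCLike.re_eq_complex_re, Complex.re_ofReal_mul] at h1
    rw [integral_prod_kernelCoeff_mul_mFourier, Complex.ofReal_re] at h1
    simp only [mul_comm _ (Γ _)]
    rw [h1, korobovCoeff_sqrtModifiedWeights_sq γ hn]
    refine mul_le_mul_of_nonneg_left ?_ (NNReal.coe_nonneg _)
    refine (le_abs_self _).trans ?_
    rw [Finset.abs_prod]
    refine Finset.prod_le_prod (fun _ _ => abs_nonneg _) fun j hj => ?_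
    exact abs_integral_kernelCoeff_mul_cos_le (by simpa using hj)
  have hξn' : ‖ξ‖ ≤ korobovCoeff 1 (sqrtModifiedWeights γ) n :=
    (sq_le_sq₀ (norm_nonneg _) (korobovCoeff_nonneg _ _ _)).mp hξn
  have hI : Integrable fun u => UnitAddTorus.mFourier n u * (f (tentTorus u) : ℂ) :=
    integrable_of_continuous _ ((UnitAddTorus.mFourier n).continuous.mul
      (Complex.continuous_ofReal.comp hfc))
  have e : ∫ u, UnitAddTorus.mFourier n u * (f (tentTorus u) : ℂ) = ((inner ℝ f ξ : ℝ) : ℂ) := by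
    refine Complex.ext ?_ ?_
    · have h1 := integral_re hI
      simp only [RCLike.re_eq_complex_re, Complex.re_mul_ofReal] at h1
      rw [← h1, Complex.ofReal_re, hξ, inner_integralRep _ hk continuous_tentTorus hre]
    · have h1 := integral_im hI
      simp only [RCLike.im_eq_complex_im, Complex.im_mul_ofReal] at h1
      rw [← h1, Complex.ofReal_im, ← inner_integralRep _ hk continuous_tentTorus him f, ← hη, hη0,
        inner_zero_right]
  rw [e, Complex.norm_real]
  exact (norm_inner_le_norm f ξ).trans (mul_le_mul_of_nonneg_left hξn' (norm_nonneg _))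

theorem korobovCoeff_neg (α : ℝ) (w : Weights s) (n : Fin s → ℤ) :
    korobovCoeff α w (-n) = korobovCoeff α w n := by
  simp [korobovCoeff]

/-- The error of a tent transformed lattice rule in the Sobolev space is at most the squared
error of the lattice rule in the Korobov space. -/
theorem worstCaseError_tentLatticePoints_le {N : ℕ} (hN : N ≠ 0) (z : Fin s → ℕ) :
    worstCaseError (SobolevSpace 2 γ) (tentLatticePoints N z)
      ≤ dualSum (sqrtModifiedWeights γ) N z := by
  classical
  refine iSup₂_le fun f hf => ?_
  set r := korobovCoeff 1 (sqrtModifiedWeights γ) with hr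
  have hk := continuous_sobolevKernel γ
  have hfc := continuous_of_continuous_kernel hk f
  let F : C(UnitAddTorus (Fin s), ℂ) := ⟨fun u => (f (tentTorus u) : ℂ),
    Complex.continuous_ofReal.comp (hfc.comp continuous_tentTorus)⟩
  set c := UnitAddTorus.mFourierCoeff F with hc
  have hcn : ∀ n ≠ 0, ‖c n‖ ≤ r n := by
    intro n hn
    -- The coefficient at n integrates against the character of -n; r is even.
    rw [hc, mFourierCoeff_eq_integral_volume, hr, ← korobovCoeff_neg]
    refine (norm_integral_mFourier_mul_le γ (neg_ne_zero.mpr hn) f).trans ?_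
    exact mul_le_of_le_one_left (korobovCoeff_nonneg _ _ _) hf
  have hc0 : c 0 = ((∫ x : Cube s, f x : ℝ) : ℂ) := by
    rw [hc, mFourierCoeff_eq_integral_volume, neg_zero, UnitAddTorus.mFourier_zero]
    simp only [ContinuousMap.one_apply, one_mul]
    rw [← integral_comp_tentTorus hfc, ← integral_complex_ofReal]
    rfl
  -- Absolute summability makes the Fourier series converge at every point, so it may be evaluated
  -- at the lattice points.
  have hsum : Summable c := by
    refine Summable.of_norm_bounded_eventually (summable_korobovCoeff (sqrtModifiedWeights γ)) ?_
    filter_upwards [(Set.finite_singleton (0 : Fin s → ℤ)).compl_mem_cofinite] with n hn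
    exact hcn n hn
  have hser := UnitAddTorus.hasSum_mFourier_series_apply_of_summable hsum
  have hq : HasSum (fun n => (∑ k ∈ Finset.range N,
      c n • UnitAddTorus.mFourier n (toTorus (latticePoint N z k))) / N)
      ((∑ k ∈ Finset.range N, F (toTorus (latticePoint N z k))) / N) :=
    (hasSum_sum fun k _ => hser (toTorus (latticePoint N z k))).div_const _
  have hq' : (∑ k ∈ Finset.range N, F (toTorus (latticePoint N z k))) / N
      = ((qmc (tentLatticePoints N z) f : ℝ) : ℂ) := by
    rw [qmc_tentLatticePoints]
    push_cast
    congr 1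
    refine Finset.sum_congr rfl fun k _ => ?_
    simp only [tent_eq_tentCircle]
    rfl
  have hterm : ∀ n, (∑ k ∈ Finset.range N,
      c n • UnitAddTorus.mFourier n (toTorus (latticePoint N z k))) / N
      = if (N : ℤ) ∣ ∑ j, n j * (z j : ℤ) then c n else 0 := by
    intro n
    rw [← Finset.smul_sum, smul_eq_mul, mul_div_assoc, sum_mFourier_latticePoint hN]
    split_ifs <;> simp
  rw [hq'] at hq
  simp only [hterm] at hq
  have hdiff := hq.sub (hasSum_ite_eq (0 : Fin s → ℤ) (c 0))
  have e : ∀ n : Fin s → ℤ, (if (N : ℤ) ∣ ∑ j, n j * (z j : ℤ) then c n else 0)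
      - (if n = 0 then c 0 else 0)
      = if n ≠ 0 ∧ (N : ℤ) ∣ ∑ j, n j * (z j : ℤ) then c n else 0 := by
    intro n
    rcases eq_or_ne n 0 with rfl | h0
    · simp
    · simp [h0]
  simp only [e] at hdiff
  have hrs : Summable fun n : Fin s → ℤ =>
      if n ≠ 0 ∧ (N : ℤ) ∣ ∑ j, n j * (z j : ℤ) then r n else 0 := by
    refine (summable_korobovCoeff (sqrtModifiedWeights γ)).of_nonneg_of_le (fun n => ?_)
      (fun n => ?_)
    · split_ifs
      · exact korobovCoeff_nonneg _ _ _
      · exact le_rfl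
    · split_ifs
      · exact le_rfl
      · exact korobovCoeff_nonneg _ _ _
  have hle := tsum_of_norm_bounded hrs.hasSum (f := fun n : Fin s → ℤ =>
      if n ≠ 0 ∧ (N : ℤ) ∣ ∑ j, n j * (z j : ℤ) then c n else 0) (fun n => by
    split_ifs with h
    · exact hcn n h.1
    · simp)
  rw [hdiff.tsum_eq, hc0, ← Complex.ofReal_sub, Complex.norm_real, Real.norm_eq_abs] at hle
  refine (ENNReal.ofReal_le_ofReal hle).trans (le_of_eq ?_)
  rw [dualSum, ENNReal.ofReal_tsum_of_nonneg (fun n => ?_) hrs]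
  · refine tsum_congr fun n => ?_
    split_ifs <;> simp [hr]
  · split_ifs
    · exact korobovCoeff_nonneg _ _ _
    · exact le_rfl

end

/-! ### Explicit bounds -/

/-- Since (4π^4)^(l/2) = 2^l π^(2l), the factor 2 of the two-sided zeta sum turns into 2^(1-l). -/
theorem sqrtModifiedWeights_rpow_mul {s : ℕ} (γ : Weights s) {l : ℝ} (hl : 1 / 2 < l)
    (u : Finset (Fin s)) :
    (sqrtModifiedWeights γ u : ℝ≥0∞) ^ l * bilateralZeta l ^ u.card
      = ENNReal.ofReal ((γ u : ℝ) ^ (l / 2) *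
        (2 ^ (1 - l) * (cPrime : ℝ) ^ (l / 2) * (riemannZeta (2 * (l : ℂ))).re /
          Real.pi ^ (2 * l)) ^ u.card) := by
  have hpi := Real.pi_pos
  have hz := riemannZeta_re_nonneg hl
  have hc : (0 : ℝ) ≤ cPrime := NNReal.coe_nonneg _
  rw [bilateralZeta_eq hl, ← ENNReal.ofReal_coe_nnreal, ENNReal.ofReal_rpow_of_nonneg
    (NNReal.coe_nonneg _) (by linarith), ← ENNReal.ofReal_pow (by positivity),
    ← ENNReal.ofReal_mul (by positivity)]
  congr 1
  have hw : (sqrtModifiedWeights γ u : ℝ) ^ l = (γ u : ℝ) ^ (l / 2)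
      * (((cPrime : ℝ) / (4 * Real.pi ^ 4)) ^ (l / 2)) ^ u.card := by
    rw [sqrtModifiedWeights]
    push_cast
    rw [NNReal.coe_real_pi, Real.sqrt_eq_rpow, ← Real.rpow_mul (by positivity),
      show 1 / 2 * l = l / 2 by ring, Real.mul_rpow (by positivity) (by positivity),
      ← Real.rpow_natCast _ u.card, ← Real.rpow_natCast _ u.card, ← Real.rpow_mul (by positivity),
      ← Real.rpow_mul (by positivity), mul_comm (u.card : ℝ)]
  rw [hw, mul_assoc, ← mul_pow]
  congr 2
  have h4 : (4 * Real.pi ^ 4) ^ (l / 2) = 2 ^ l * Real.pi ^ (2 * l) := by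
    rw [show 4 * Real.pi ^ 4 = (2 * Real.pi ^ 2) ^ 2 by ring, ← Real.rpow_natCast (2 * Real.pi ^ 2),
      ← Real.rpow_mul (by positivity), show ((2 : ℕ) : ℝ) * (l / 2) = l by push_cast; ring,
      Real.mul_rpow (by positivity) (by positivity), ← Real.rpow_natCast Real.pi,
      ← Real.rpow_mul (by positivity)]
    norm_num
  rw [Real.div_rpow hc (by positivity), h4, Real.rpow_sub two_pos, Real.rpow_one]
  field_simp

/-- The right hand side of the error bound, without the factor depending on `N`. -/
def weightSum {s : ℕ} (γ : Weights s) (l : ℝ) : ℝ :=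
  ∑ u : Finset (Fin s) with u.Nonempty, (γ u : ℝ) ^ (l / 2) *
    (2 ^ (1 - l) * (cPrime : ℝ) ^ (l / 2) * (riemannZeta (2 * (l : ℂ))).re /
      Real.pi ^ (2 * l)) ^ u.card

theorem weightSum_term_nonneg {s : ℕ} (γ : Weights s) {l : ℝ} (hl : 1 / 2 < l)
    (u : Finset (Fin s)) : 0 ≤ (γ u : ℝ) ^ (l / 2) *
      (2 ^ (1 - l) * (cPrime : ℝ) ^ (l / 2) * (riemannZeta (2 * (l : ℂ))).re /
        Real.pi ^ (2 * l)) ^ u.card := by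
  have hpi := Real.pi_pos
  have hz := riemannZeta_re_nonneg hl
  positivity

theorem weightSum_nonneg {s : ℕ} (γ : Weights s) {l : ℝ} (hl : 1 / 2 < l) : 0 ≤ weightSum γ l :=
  Finset.sum_nonneg fun u _ => weightSum_term_nonneg γ hl u

theorem dualSum_le_of_isCBCOutput {s N : ℕ} (hN : N.Prime) (γ : Weights s)
    {z : Fin s → ℕ} (hz : IsCBCOutput N (korobovCriterion γ N) z) {l : ℝ} (hl : 1 / 2 < l)
    (hl1 : l ≤ 1) :
    dualSum (sqrtModifiedWeights γ) N z ≤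
      ENNReal.ofReal (1 / ((N : ℝ) - 1) ^ (1 / l) * weightSum γ l ^ (1 / l)) := by
  have hl0 : 0 < l := by linarith
  have h := mul_dualSum_rpow_le (sqrtModifiedWeights γ) hN z
    (fun i c hc => lastSum_le_of_isCBCOutput hN.ne_zero γ hz i hc) hl hl1
  simp only [sqrtModifiedWeights_rpow_mul γ hl] at h
  rw [← ENNReal.ofReal_sum_of_nonneg fun u _ => weightSum_term_nonneg γ hl u] at h
  change _ ≤ ENNReal.ofReal (weightSum γ l) at h
  have hN1 : 0 < (N : ℝ) - 1 := by
    have : (1 : ℝ) < N := by exact_mod_cast hN.one_lt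
    linarith
  have hcast : ((N - 1 : ℕ) : ℝ≥0∞) = ENNReal.ofReal ((N : ℝ) - 1) := by
    rw [← ENNReal.ofReal_natCast, Nat.cast_sub hN.one_lt.le, Nat.cast_one]
  rw [hcast, mul_comm, ← ENNReal.le_div_iff_mul_le (Or.inl (by simpa using hN1))
    (Or.inl ENNReal.ofReal_ne_top), ← ENNReal.ofReal_div_of_pos hN1,
    ← ENNReal.le_rpow_inv_iff hl0, ENNReal.ofReal_rpow_of_nonneg
    (div_nonneg (weightSum_nonneg γ hl) hN1.le) (by positivity),
    Real.div_rpow (weightSum_nonneg γ hl) hN1.le] at h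
  rwa [one_div l, one_div_mul_eq_div]

theorem exists_dualSum_le {s : ℕ} (γ : Weights s) {ε : ℝ} (hε : 0 < ε) :
    ∃ C : ℝ, ∀ N : ℕ, N.Prime → ∀ z : Fin s → ℕ, IsCBCOutput N (korobovCriterion γ N) z →
      dualSum (sqrtModifiedWeights γ) N z ≤ ENNReal.ofReal (C * (N : ℝ) ^ (-2 + ε)) := by
  -- The exponent used is l = 1/(2 - δ), so 1/l = 2 - δ; truncating ε at 1 keeps l ≤ 1, and δ > 0
  -- gives l > 1/2.
  set δ := min ε 1 with hδ
  have hδ0 : 0 < δ := lt_min hε one_pos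
  have hδ1 : δ ≤ 1 := min_le_right _ _
  have hδε : δ ≤ ε := min_le_left _ _
  have hl : 1 / 2 < 1 / (2 - δ) := one_div_lt_one_div_of_lt (by linarith) (by linarith)
  have hl1 : 1 / (2 - δ) ≤ 1 := by
    rw [div_le_one (by linarith)]
    linarith
  refine ⟨2 ^ (2 - δ) * weightSum γ (1 / (2 - δ)) ^ (2 - δ), fun N hN z hz => ?_⟩
  refine (dualSum_le_of_isCBCOutput hN γ hz hl hl1).trans (ENNReal.ofReal_le_ofReal ?_)
  have hN2 : (2 : ℝ) ≤ N := by exact_mod_cast hN.two_le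
  have hw := Real.rpow_nonneg (weightSum_nonneg γ hl) (2 - δ)
  rw [one_div_one_div]
  have h1 : 1 / ((N : ℝ) - 1) ^ (2 - δ) ≤ 2 ^ (2 - δ) * (N : ℝ) ^ (-2 + ε) := by
    -- N - 1 ≥ N/2 for N ≥ 2, at the price of the factor 2^(2-δ) in the constant.
    calc 1 / ((N : ℝ) - 1) ^ (2 - δ) ≤ 1 / ((N : ℝ) / 2) ^ (2 - δ) := by
          refine one_div_le_one_div_of_le (by positivity) ?_
          exact Real.rpow_le_rpow (by positivity) (by linarith) (by linarith)
      _ = 2 ^ (2 - δ) * (N : ℝ) ^ (-(2 - δ)) := by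
          rw [Real.div_rpow (by positivity) two_pos.le, one_div_div, Real.rpow_neg (by positivity)]
          rfl
      _ ≤ 2 ^ (2 - δ) * (N : ℝ) ^ (-2 + ε) := by
          refine mul_le_mul_of_nonneg_left ?_ (by positivity)
          exact Real.rpow_le_rpow_of_exponent_le (by linarith) (by linarith)
  calc 1 / ((N : ℝ) - 1) ^ (2 - δ) * weightSum γ (1 / (2 - δ)) ^ (2 - δ)
      ≤ 2 ^ (2 - δ) * (N : ℝ) ^ (-2 + ε) * weightSum γ (1 / (2 - δ)) ^ (2 - δ) :=
        mul_le_mul_of_nonneg_right h1 hw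
    _ = _ := by ring

end TentLattice
end

open TentLattice
theorem corollary1 (s : ℕ) (hs : 1 ≤ s) (γ : Weights s) :
    (∀ N : ℕ, N.Prime →
      (∃ z : Fin s → ℕ, IsCBCOutput N (korobovCriterion γ N) z) ∧
      ∀ z : Fin s → ℕ, IsCBCOutput N (korobovCriterion γ N) z →
        worstCaseError (SobolevSpace 2 γ) (tentLatticePoints N z) ≤
            worstCaseError (KorobovSpace 1 (sqrtModifiedWeights γ)) (latticePoints N z) ^ 2 ∧
        ∀ l : ℝ, 1 / 2 < l → l ≤ 1 →
          worstCaseError (KorobovSpace 1 (sqrtModifiedWeights γ)) (latticePoints N z) ^ 2 ≤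
            ENNReal.ofReal (1 / ((N : ℝ) - 1) ^ (1 / l) *
              (∑ u : Finset (Fin s) with u.Nonempty,
                (γ u : ℝ) ^ (l / 2) *
                  (2 ^ (1 - l) * (cPrime : ℝ) ^ (l / 2) * (riemannZeta (2 * (l : ℂ))).re /
                    Real.pi ^ (2 * l)) ^ u.card) ^ (1 / l))) ∧
    (∀ ε : ℝ, 0 < ε → ∃ C : ℝ, ∀ N : ℕ, N.Prime →
      ∀ z : Fin s → ℕ, IsCBCOutput N (korobovCriterion γ N) z →
        worstCaseError (SobolevSpace 2 γ) (tentLatticePoints N z) ≤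
          ENNReal.ofReal (C * (N : ℝ) ^ (-2 + ε))) ∧
    ((∀ f : SobolevSpace 2 γ, Integrable (fun x : Cube s => f x)) ∧
      ∀ f : KorobovSpace 1 (sqrtModifiedWeights γ), Integrable (fun x : Cube s => f x)) := by
  refine ⟨fun N hN => ⟨exists_isCBCOutput hN.two_le _, fun z hz => ⟨?_, fun l hl hl1 => ?_⟩⟩,
    fun ε hε => ?_, fun f => ?_, fun f => ?_⟩
  · rw [worstCaseError_korobovSpace_sq _ hN.ne_zero]
    exact worstCaseError_tentLatticePoints_le γ hN.ne_zero z
  · rw [worstCaseError_korobovSpace_sq _ hN.ne_zero]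
    exact dualSum_le_of_isCBCOutput hN γ hz hl hl1
  · obtain ⟨C, hC⟩ := exists_dualSum_le γ hε
    exact ⟨C, fun N hN z hz =>
      (worstCaseError_tentLatticePoints_le γ hN.ne_zero z).trans (hC N hN z hz)⟩
  · exact integrable_of_continuous _
      (continuous_of_continuous_kernel (continuous_sobolevKernel γ) f)
  · exact integrable_of_continuous _
      (continuous_of_continuous_kernel (continuous_korobovKernel (sqrtModifiedWeights γ)) f)
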